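/- **Lemma.** Let $d\ge 1$. Given a list $P$ of $n$ points, store it in a quadtree over $[0,1]^d$ of height $h=\lceil(\log_2 n)/d\rceil$: every inner node has $2^d$ children, and the points are inserted one by one, by direct array indexing, into the $2^h\times\cdots\times2^h$ grid of leaf cells (points outside the cube are assigned to boundary cells). Traverse the tree bottom-up. At a leaf, compute the convex hull (possibly empty) of the points stored there by a convex hull procedure $\mathcal A$. At an inner node, collect the vertices of the convex hulls of the children in a list $S$, and compute the convex hull of $S$ by a convex hull procedure $\mathcal B$. Here a convex hull procedure is one that, for every finite list of points of $\mathbb R^d$ (possibly empty, with repetitions, or degenerate), returns the vertices of the convex hull and all its nonempty faces, each face given by its vertices. Running time is the number of steps on a unit-cost real RAM (arithmetic, comparisons and floor on reals, integer arithmetic, list operations, array access), and includes the construction of the quadtree. 1. If $\mathcal A$ and $\mathcal B$ are the explicit brute force procedure that tests each point for being a vertex and finds the faces as the smallest faces containing at most $d+1$ given vertices, both by Fourier–Motzkin elimination, then the algorithm computes the convex hull $\mathrm{CH}(P)$ of every finite list $P$ of points, and there is a constant $C$ depending only on $d$ such that for every $n\ge1$ its expected running time on $n$ points chosen independently and uniformly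 from $[0,1]^d$ is at most $Cn$. 2. More generally, for all $c,\kappa\in\mathbb N$ there is a constant $C$, depending only on $d,c,\kappa$, such that the following holds for all deterministic convex hull procedures $\mathcal A,\mathcal B$ that take at most $c\,(m+1)^\kappa$ steps on every list of $m$ points (for example any brute force procedure of polynomial running time for $\mathcal A$, and for $\mathcal B$ any algorithm with running time $O(m\log m+m^{\lfloor d/2\rfloor})$): the algorithm computes $\mathrm{CH}(P)$ for every finite list $P$ of points, and for every $n\ge1$ its expected running time on $n$ independent uniform points of $[0,1]^d$ is at most $Cn$. (If the running time is not a measurable function of the points, the expectation is the upper integral.) -/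

import Mathlib

open MeasureTheory
open scoped ENNReal NNReal

noncomputable section

namespace QuadtreeHull

/-! ## The cost model: a unit-cost real RAM

A value of type `Timed α` is the result of a computation together with the number of elementary
steps that were executed. Elementary steps are: an arithmetic operation, comparison or floor on
real numbers, an arithmetic operation or comparison on integers, building or inspecting a
constructor (a list cell, a tree node), reading or writing a memory cell. Programs are written with
the primitives below and the loops built from them; each primitive charges its own steps, and
sequencing adds them up. -/

/-- A result together with the number of steps spent on computing it. -/
@[ext] structure Timed (α : Type) where
  val : α
  time : ℕ

/-- Return `a` and charge `c` steps. -/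
def charge {α : Type} (c : ℕ) (a : α) : Timed α := ⟨a, c⟩

instance : Monad Timed where
  pure a := ⟨a, 0⟩
  bind x f := ⟨(f x.val).val, x.time + (f x.val).time⟩

@[simp] theorem val_pure {α : Type} (a : α) : (pure a : Timed α).val = a := rfl
@[simp] theorem time_pure {α : Type} (a : α) : (pure a : Timed α).time = 0 := rfl
@[simp] theorem val_bind {α β : Type} (x : Timed α) (f : α → Timed β) :
    (x >>= f).val = (f x.val).val := rfl
@[simp] theorem time_bind {α β : Type} (x : Timed α) (f : α → Timed β) :
    (x >>= f).time = x.time + (f x.val).time := rfl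
@[simp] theorem val_charge {α : Type} (c : ℕ) (a : α) : (charge c a).val = a := rfl
@[simp] theorem time_charge {α : Type} (c : ℕ) (a : α) : (charge c a).time = c := rfl

/-! Primitives on real numbers. -/

def subT (x y : ℝ) : Timed ℝ := charge 1 (x - y)
def mulT (x y : ℝ) : Timed ℝ := charge 1 (x * y)
def ltT (x y : ℝ) : Timed Bool := charge 1 (decide (x < y))
def eqT (x y : ℝ) : Timed Bool := charge 1 (decide (x = y))
def floorT (x : ℝ) : Timed ℕ := charge 1 ⌊x⌋₊

/-! Primitives on natural numbers and Booleans. -/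

def natAddT (a b : ℕ) : Timed ℕ := charge 1 (a + b)
def natMulT (a b : ℕ) : Timed ℕ := charge 1 (a * b)
def natMinT (a b : ℕ) : Timed ℕ := charge 1 (min a b)
def natPredT (a : ℕ) : Timed ℕ := charge 1 (a - 1)
def natLtT (a b : ℕ) : Timed Bool := charge 1 (decide (a < b))
def testBitT (a j : ℕ) : Timed Bool := charge 1 (a.testBit j)
def notT (b : Bool) : Timed Bool := charge 1 (!b)
def orT (a b : Bool) : Timed Bool := charge 1 (a || b)

/-- Compute the entries of an array of length `k` one after the other and store them. -/
def tabulateT {α : Type} {k : ℕ} (f : Fin k → Timed α) : Timed (Fin k → α) :=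
  ⟨fun i => (f i).val, 1 + ∑ i, ((f i).time + 1)⟩

/-! Loops over lists. -/

def lengthT {α : Type} : List α → Timed ℕ
  | [] => charge 1 0
  | _ :: l => do
    let n ← lengthT l
    natAddT n 1

def mapT {α β : Type} (f : α → Timed β) : List α → Timed (List β)
  | [] => charge 1 []
  | a :: l => do
    let b ← f a
    let bs ← mapT f l
    charge 1 (b :: bs)

def filterT {α : Type} (f : α → Timed Bool) : List α → Timed (List α)
  | [] => charge 1 []
  | a :: l => do
    let b ← f a
    let r ← filterT f l
    if b then charge 1 (a :: r) else charge 1 r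

def allT {α : Type} (f : α → Timed Bool) : List α → Timed Bool
  | [] => charge 1 true
  | a :: l => do
    let b ← f a
    if b then allT f l else charge 1 false

def anyT {α : Type} (f : α → Timed Bool) : List α → Timed Bool
  | [] => charge 1 false
  | a :: l => do
    let b ← f a
    if b then charge 1 true else anyT f l

def appendT {α : Type} : List α → List α → Timed (List α)
  | [], m => charge 1 m
  | a :: l, m => do
    let r ← appendT l m
    charge 1 (a :: r)

def concatT {α : Type} : List (List α) → Timed (List α)
  | [] => charge 1 []
  | l :: ls => do
    let r ← concatT ls
    appendT l r

/-- Remove duplicates with respect to the equality test `eq`. -/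
def dedupT {α : Type} (eq : α → α → Timed Bool) : List α → Timed (List α)
  | [] => charge 1 []
  | a :: l => do
    let r ← dedupT eq l
    let b ← anyT (eq a) r
    if b then charge 1 r else charge 1 (a :: r)

/-- All sublists with at most `k` elements. -/
def shortSublistsT {α : Type} : ℕ → List α → Timed (List (List α))
  | _, [] => charge 1 [[]]
  | 0, _ :: _ => charge 1 [[]]
  | k + 1, a :: l => do
    let without ← shortSublistsT (k + 1) l
    let shorter ← shortSublistsT k l
    let withHead ← mapT (fun t => charge 1 (a :: t)) shorter
    appendT without withHead

/-! ## Convex hulls of finite point sets -/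

/-- Points of `ℝ^d`. -/
abbrev Pt (d : ℕ) : Type := Fin d → ℝ

/-- The convex hull of the points in a list. -/
def hullSet {d : ℕ} (l : List (Pt d)) : Set (Pt d) := convexHull ℝ {x | x ∈ l}

/-- The output format of a convex hull algorithm: the list of vertices, and the list of nonempty
faces of all dimensions, every face being given by the list of its vertices. -/
structure Hull (d : ℕ) where
  vertices : List (Pt d)
  faces : List (List (Pt d))

/-- `H` is the convex hull of the points in `pts`: its vertices are listed without repetition, and
so are its nonempty faces, each by its vertices (again without repetition). -/
structure IsHull {d : ℕ} (pts : List (Pt d)) (H : Hull d) : Prop where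
  vertices_nodup : H.vertices.Nodup
  vertices_eq : {x | x ∈ H.vertices} = (hullSet pts).extremePoints ℝ
  faces_wf : ∀ F ∈ H.faces, F ≠ [] ∧ F.Nodup ∧ (∀ x ∈ F, x ∈ H.vertices) ∧
    IsExposed ℝ (hullSet pts) (hullSet F)
  faces_complete : ∀ B : Set (Pt d), B.Nonempty → IsExposed ℝ (hullSet pts) B →
    ∃ F ∈ H.faces, hullSet F = B
  faces_distinct : H.faces.Pairwise fun F G => hullSet F ≠ hullSet G

/-- A procedure computing convex hulls of point lists (which may be empty, or contain repeated or
affinely dependent points). -/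
def ComputesHull {d : ℕ} (alg : List (Pt d) → Timed (Hull d)) : Prop :=
  ∀ pts, IsHull pts (alg pts).val

/-- On `m` points the procedure takes at most `c * (m + 1) ^ κ` steps. -/
def RunsInTime {d : ℕ} (alg : List (Pt d) → Timed (Hull d)) (c κ : ℕ) : Prop :=
  ∀ pts, (alg pts).time ≤ c * (pts.length + 1) ^ κ

/-! ## A brute force convex hull algorithm -/

/-- The homogeneous inequality `∑ i, coeff i * u i < 0` (if `strict`) or `≤ 0` (otherwise) in the
unknown vector `u`. -/
structure Constraint (k : ℕ) where
  coeff : Fin k → ℝ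
  strict : Bool

/-- Elimination of the unknown `u 0` from a constraint in which it has a positive coefficient and
one in which it has a negative coefficient. -/
def combineT {k : ℕ} (p q : Constraint (k + 1)) : Timed (Constraint k) := do
  let v ← tabulateT fun i : Fin k => do
    let x ← mulT (p.coeff 0) (q.coeff i.succ)
    let y ← mulT (q.coeff 0) (p.coeff i.succ)
    subT x y
  let s ← orT p.strict q.strict
  charge 1 ⟨v, s⟩

def dropFirstT {k : ℕ} (p : Constraint (k + 1)) : Timed (Constraint k) := do
  let v ← tabulateT fun i : Fin k => charge 1 (p.coeff i.succ)
  charge 1 ⟨v, p.strict⟩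

/-- Does the system have a solution? Decided by Fourier-Motzkin elimination. -/
def feasibleT : (k : ℕ) → List (Constraint k) → Timed Bool
  | 0, cs => allT (fun p => notT p.strict) cs
  | k + 1, cs => do
    let pos ← filterT (fun p => ltT 0 (p.coeff 0)) cs
    let neg ← filterT (fun p => ltT (p.coeff 0) 0) cs
    let zero ← filterT (fun p => eqT (p.coeff 0) 0) cs
    let kept ← mapT dropFirstT zero
    let pairs ← mapT (fun p => mapT (combineT p) neg) pos
    let new ← concatT pairs
    let cs' ← appendT kept new
    feasibleT k cs'

/-- The constraint that the functional `u` is smaller (`strict`), or not larger, at `x` than at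
`y`. -/
def belowT {d : ℕ} (strict : Bool) (x y : Pt d) : Timed (Constraint d) := do
  let v ← tabulateT fun i => subT (x i) (y i)
  charge 1 ⟨v, strict⟩

def ptEqT {d : ℕ} (x y : Pt d) : Timed Bool :=
  allT (fun i => eqT (x i) (y i)) (List.finRange d)

def listEqT {d : ℕ} : List (Pt d) → List (Pt d) → Timed Bool
  | [], [] => charge 1 true
  | [], _ :: _ => charge 1 false
  | _ :: _, [] => charge 1 false
  | x :: l, y :: m => do
    let b ← ptEqT x y
    if b then listEqT l m else charge 1 false

/-- Is some linear functional larger at `p` than at all other points of `pts`? -/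
def isVertexT {d : ℕ} (pts : List (Pt d)) (p : Pt d) : Timed Bool := do
  let others ← filterT (fun x => do
    let b ← ptEqT x p
    notT b) pts
  let cs ← mapT (fun x => belowT true x p) others
  feasibleT d cs

/-- Does `x` lie on every face of the hull of `V` that contains `t₀` and the points of `T`? -/
def onAllFacesT {d : ℕ} (V : List (Pt d)) (t₀ : Pt d) (T : List (Pt d)) (x : Pt d) :
    Timed Bool := do
  let support ← mapT (fun y => belowT false y t₀) V
  let contact ← mapT (fun t => belowT false t₀ t) T
  let cs ← appendT support contact
  let s ← belowT true x t₀
  let b ← feasibleT d (s :: cs)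
  notT b

/-- The vertices of the smallest face containing `T` (empty if `T` is). -/
def smallestFaceT {d : ℕ} (V : List (Pt d)) : List (Pt d) → Timed (List (Pt d))
  | [] => charge 1 []
  | t₀ :: T => filterT (onAllFacesT V t₀ T) V

/-- Brute force: test every point for being a vertex, and find all faces as the smallest faces
containing at most `d + 1` vertices. -/
def bruteForceHull {d : ℕ} (pts : List (Pt d)) : Timed (Hull d) := do
  let distinct ← dedupT ptEqT pts
  let V ← filterT (isVertexT distinct) distinct
  let seeds ← shortSublistsT (d + 1) V
  let cands ← mapT (smallestFaceT V) seeds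
  let nonempty ← filterT (fun F => charge 1 (!F.isEmpty)) cands
  let faces ← dedupT listEqT nonempty
  charge 1 ⟨V, faces⟩

/-! ## The quadtree -/

/-- A quadtree in `ℝ^d`: an inner node has `2 ^ d` children, a leaf stores a list of points. -/
inductive QuadTree (d : ℕ) : Type
  | leaf (pts : List (Pt d)) : QuadTree d
  | node (children : Fin (2 ^ d) → QuadTree d) : QuadTree d

/-- A `d`-dimensional array of point lists. -/
abbrev Grid (d : ℕ) : Type := (Fin d → ℕ) → List (Pt d)

/-- Allocate an array of side length `w`, all of whose entries are empty lists: one step per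
entry. -/
def newGridT (d w : ℕ) : Timed (Grid d) := charge (w ^ d + 1) fun _ => []

/-- Read an entry: `2 * d` steps for the address arithmetic, one for the access. -/
def readT {d : ℕ} (g : Grid d) (c : Fin d → ℕ) : Timed (List (Pt d)) := charge (2 * d + 1) (g c)

/-- Overwrite an entry. -/
def writeT {d : ℕ} (g : Grid d) (c : Fin d → ℕ) (l : List (Pt d)) : Timed (Grid d) :=
  charge (2 * d + 1) (Function.update g c l)

/-- `2 ^ k`, by repeated doubling. -/
def powTwoT : ℕ → Timed ℕ
  | 0 => charge 1 1
  | k + 1 => do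
    let t ← powTwoT k
    natMulT 2 t

/-- The loop that finds the height of the tree: it increases `h`, maintaining `w = 2 ^ h` and
`t = b ^ h` with `b = 2 ^ d`, until `n ≤ t`. The first argument bounds the number of rounds. -/
def heightLoopT (b n : ℕ) : ℕ → ℕ → ℕ → ℕ → Timed (ℕ × ℕ)
  | 0, h, w, _ => charge 1 (h, w)
  | fuel + 1, h, w, t => do
    let small ← natLtT t n
    if small then
      let h' ← natAddT h 1
      let w' ← natMulT 2 w
      let t' ← natMulT b t
      heightLoopT b n fuel h' w' t'
    else charge 1 (h, w)

/-- The height of the tree and the number of leaf cells along each axis, for `n` points. -/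
def heightT (d n : ℕ) : Timed (ℕ × ℕ) := do
  let b ← powTwoT d
  heightLoopT b n n 0 1 1

/-- The cell of the `w × ⋯ × w` grid over the unit cube that contains `p`; cells are half-open,
except that the last ones along each axis contain their far side. -/
def cellOfT {d : ℕ} (w : ℕ) (p : Pt d) : Timed (Fin d → ℕ) :=
  tabulateT fun j => do
    let y ← mulT (p j) (w : ℝ)
    let z ← floorT y
    let last ← natPredT w
    natMinT z last

/-- Insert the points one by one into the grid of leaf cells. -/
def fillGridT {d : ℕ} (w : ℕ) : List (Pt d) → Grid d → Timed (Grid d)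
  | [], g => charge 1 g
  | p :: ps, g => do
    let c ← cellOfT w p
    let l ← readT g c
    let g' ← writeT g c (p :: l)
    fillGridT w ps g'

/-- The `b`-th child cell of the cell with integer coordinates `c`, on the next finer grid. -/
def childCellT {d : ℕ} (c : Fin d → ℕ) (b : Fin (2 ^ d)) : Timed (Fin d → ℕ) :=
  tabulateT fun j => do
    let e ← natMulT 2 (c j)
    let bit ← testBitT b j
    if bit then natAddT e 1 else charge 1 e

/-- The subtree of height `k` below the cell `c`, over the grid `g` of leaf cells. -/
def buildTreeT {d : ℕ} (g : Grid d) : ℕ → (Fin d → ℕ) → Timed (QuadTree d)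
  | 0, c => do
    let l ← readT g c
    charge 1 (.leaf l)
  | k + 1, c => do
    let ch ← tabulateT fun b => do
      let c' ← childCellT c b
      buildTreeT g k c'
    charge 1 (.node ch)

/-- The quadtree of height `⌈log₂ n / d⌉` over the unit cube, storing the `n` given points in its
leaves. -/
def quadTreeT {d : ℕ} (pts : List (Pt d)) : Timed (QuadTree d) := do
  let n ← lengthT pts
  let hw ← heightT d n
  let g₀ ← newGridT d hw.2
  let g ← fillGridT hw.2 pts g₀
  let root ← tabulateT fun _ : Fin d => charge 1 0
  buildTreeT g hw.1 root

/-! ## The convex hull algorithm -/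

/-- Bottom-up traversal: at a leaf, `leafHull` is run on the points stored there; at an inner node,
the vertices of the hulls of the children are collected, and `mergeHull` is run on them. -/
def traverseT {d : ℕ} (leafHull mergeHull : List (Pt d) → Timed (Hull d)) :
    QuadTree d → Timed (Hull d)
  | .leaf pts => do
    let H ← leafHull pts
    charge 1 H
  | .node children => do
    let hulls ← tabulateT fun b => traverseT leafHull mergeHull (children b)
    let parts ← mapT (fun b => charge 1 (hulls b).vertices) (List.finRange (2 ^ d))
    let S ← concatT parts
    mergeHull S

/-- Build the quadtree, and traverse it bottom-up. -/
def quadtreeHull {d : ℕ} (leafHull mergeHull : List (Pt d) → Timed (Hull d))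
    (pts : List (Pt d)) : Timed (Hull d) := do
  let tree ← quadTreeT pts
  traverseT leafHull mergeHull tree

/-! ## Random points and expected time -/

/-- The law of `n` independent uniform points of `[0,1]^d`. -/
def uniformSample (d n : ℕ) : Measure (Fin n → Pt d) :=
  Measure.pi fun _ => (volume : Measure (Pt d)).restrict (Set.Icc 0 1)

instance (d n : ℕ) : IsProbabilityMeasure (uniformSample d n) := by
  have h : IsProbabilityMeasure ((volume : Measure (Pt d)).restrict (Set.Icc 0 1)) :=
    ⟨by simp [Real.volume_Icc_pi]⟩
  unfold uniformSample
  infer_instance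

/-- The expectation of a nonnegative quantity, as an upper integral, so that an upper bound on it
has a meaning for an arbitrary function. -/
def upperExpectation {Ω : Type} [MeasurableSpace Ω] (μ : Measure Ω) (f : Ω → ℝ≥0∞) : ℝ≥0∞ :=
  ⨅ (g : Ω → ℝ≥0∞) (_ : Measurable g) (_ : f ≤ g), ∫⁻ ω, g ω ∂μ

/-- For a measurable function this is the usual expectation. -/
theorem upperExpectation_eq {Ω : Type} [MeasurableSpace Ω] (μ : Measure Ω) {f : Ω → ℝ≥0∞}
    (hf : Measurable f) : upperExpectation μ f = ∫⁻ ω, f ω ∂μ :=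
  le_antisymm (iInf_le_of_le f <| iInf_le_of_le hf <| iInf_le_of_le le_rfl le_rfl)
    (le_iInf fun _ => le_iInf fun _ => le_iInf fun h => lintegral_mono h)

/-- The expected running time of `alg` on `n` independent uniform points of `[0,1]^d`. -/
def expectedTime {d : ℕ} (alg : List (Pt d) → Timed (Hull d)) (n : ℕ) : ℝ≥0∞ :=
  upperExpectation (uniformSample d n) fun P => ((alg (List.ofFn P)).time : ℝ≥0∞)

/-! The height computed by the algorithm. -/

theorem powTwoT_val (k : ℕ) : (powTwoT k).val = 2 ^ k := by
  induction k with
  | zero => rfl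
  | succ k ih => simp [powTwoT, natMulT, ih, pow_succ, mul_comm]

theorem heightLoopT_val (b n : ℕ) (hb : 2 ≤ b) (fuel h : ℕ) (hh : h ≤ Nat.clog b n)
    (hf : Nat.clog b n ≤ fuel + h) :
    (heightLoopT b n fuel h (2 ^ h) (b ^ h)).val = (Nat.clog b n, 2 ^ Nat.clog b n) := by
  induction fuel generalizing h with
  | zero =>
    have : h = Nat.clog b n := by omega
    simp [heightLoopT, ← this]
  | succ f ih =>
    by_cases hlt : b ^ h < n
    · have h1 : h < Nat.clog b n := (Nat.lt_clog_iff_pow_lt hb).2 hlt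
      have := ih (h + 1) h1 (by omega)
      simpa [heightLoopT, natLtT, hlt, natAddT, natMulT, pow_succ, mul_comm] using this
    · have h1 : Nat.clog b n ≤ h := (Nat.clog_le_iff_le_pow hb).2 (not_lt.1 hlt)
      have : h = Nat.clog b n := le_antisymm hh h1
      simp [heightLoopT, natLtT, hlt, ← this]

/-- The height is `⌈log₂ n / d⌉`, and there are `2 ^ height` leaf cells along each axis. -/
theorem heightT_val (d n : ℕ) (hd : 1 ≤ d) :
    (heightT d n).val = (⌈Real.logb 2 n / d⌉₊, 2 ^ ⌈Real.logb 2 n / d⌉₊) := by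
  have hb : 2 ≤ 2 ^ d := by
    calc 2 = 2 ^ 1 := rfl
      _ ≤ 2 ^ d := Nat.pow_le_pow_right (by norm_num) hd
  have hceil : ⌈Real.logb 2 n / d⌉₊ = Nat.clog (2 ^ d) n := by
    rw [← Real.natCeil_logb_natCast]
    congr 1
    simp only [Real.logb, Nat.cast_pow, Nat.cast_ofNat, Real.log_pow]
    rw [div_div, mul_comm]
  have hle : Nat.clog (2 ^ d) n ≤ n :=
    (Nat.clog_le_iff_le_pow hb).2 (Nat.lt_pow_self hb).le
  have := heightLoopT_val (2 ^ d) n hb n 0 (Nat.zero_le _) (by simpa using hle)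
  rw [hceil]
  simpa [heightT, powTwoT_val] using this

end QuadtreeHull

end

/-!
The traversal is correct because the convex hull of a finite set is the convex hull of its vertices,
so replacing the points of a child cell by the vertices of their hull does not change the hull of
the parent's points (`isHull_traverseT`). The tree has at most `2 ^ d * n` leaves, so that building
it takes linear time. It remains to bound the expected cost of the calls of the two hull procedures,
which is polynomial in the number of points in a leaf cell, respectively in the number of vertices
that the children of an inner node contribute.

A vertex of the hull of the sample points in a cell maximizes some linear functional uniquely. Hence
no other sample point of the cell lies beyond it in the orthant given by the signs of the functional
(`vertices_length_le`), and it suffices to bound, for each of the `2 ^ d` orthants, the `p`-th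
moment of the number of undominated points. Up to constants this is the `p`-th factorial moment,
which is a sum over the `p`-sets of sample points. Given the positions of `p` points, with
dominating sets of measures `v₁, …, v_p`, the other `n - p` points avoid all of these with
probability at most `(1 - max vᵢ) ^ (n - p)`, and this is at most `∏ min 1 (2p / (n vᵢ))`. The
bound is a product of functions of the individual points, so no independence between the events
is needed (`measure_iInter_undominated_le`). Here `vᵢ` is at least the volume of the box spanned by
the point and a corner of the cell. Replacing `min 1 t` by `t ^ (1 - a)` with `a = 1 / (2p)` makes
the integral over the cell a product of integrals of `t ^ (a - 1)`. The resulting bound for the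
`p`-th moment in a cell of height `k` is a constant times `√(2 ^ d) ^ k`
(`card_mul_lintegral_weight_pow_le`).

The number of nodes of height `k` is `2 ^ (d k)` times smaller than the number of leaves, so the
expected costs of the levels form a convergent geometric series; the induction
`lintegral_sampleCost_le` sums it up.

For the brute force procedure, Fourier–Motzkin elimination decides solvability of systems of
homogeneous inequalities (`feasibleT_val`), in polynomial time for a fixed number of unknowns
(`feasibleT_time_le`). A point is a vertex if and only if it is the unique maximum of a functional,
and a face is the smallest face containing an affine basis of it, which has at most `d + 1` points
(`exists_seed`). So the first claim is a special case of the second.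
-/

open MeasureTheory
open scoped ENNReal NNReal

noncomputable section

namespace QuadtreeHull

/-! ### Values and running times of the list loops -/

@[simp] theorem val_tabulateT {α : Type} {k : ℕ} (f : Fin k → Timed α) :
    (tabulateT f).val = fun i => (f i).val := rfl

@[simp] theorem time_tabulateT {α : Type} {k : ℕ} (f : Fin k → Timed α) :
    (tabulateT f).time = 1 + ∑ i, ((f i).time + 1) := rfl

theorem val_ite {α : Type} (b : Prop) [Decidable b] (x y : Timed α) :
    (if b then x else y).val = if b then x.val else y.val := by split <;> rfl

theorem time_ite {α : Type} (b : Prop) [Decidable b] (x y : Timed α) :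
    (if b then x else y).time = if b then x.time else y.time := by split <;> rfl

theorem lengthT_val {α : Type} (l : List α) : (lengthT l).val = l.length := by
  induction l with
  | nil => rfl
  | cons a l ih => simp [lengthT, natAddT, ih]

theorem lengthT_time {α : Type} (l : List α) : (lengthT l).time = l.length + 1 := by
  induction l with
  | nil => rfl
  | cons a l ih => simp [lengthT, natAddT, ih]

theorem mapT_val {α β : Type} (f : α → Timed β) (l : List α) :
    (mapT f l).val = l.map fun a => (f a).val := by
  induction l with
  | nil => rfl
  | cons a l ih => simp [mapT, ih]

theorem mapT_time_le {α β : Type} {f : α → Timed β} {l : List α} {t m : ℕ}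
    (hf : ∀ a ∈ l, (f a).time ≤ t) (hl : l.length ≤ m) :
    (mapT f l).time ≤ (t + 1) * m + 1 := by
  refine le_trans ?_ (Nat.add_le_add_right (Nat.mul_le_mul_left _ hl) 1)
  clear hl
  induction l with
  | nil => simp [mapT]
  | cons a l ih =>
    have h1 := hf a (by simp)
    have h2 := ih fun b hb => hf b (by simp [hb])
    simp only [mapT, time_bind, time_charge, List.length_cons]
    rw [mul_add, mul_one]
    omega

theorem filterT_val {α : Type} (f : α → Timed Bool) (l : List α) :
    (filterT f l).val = l.filter fun a => (f a).val := by
  induction l with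
  | nil => rfl
  | cons a l ih => simp [filterT, List.filter_cons, val_ite, ih]

theorem filterT_time_le {α : Type} {f : α → Timed Bool} {l : List α} {t m : ℕ}
    (hf : ∀ a ∈ l, (f a).time ≤ t) (hl : l.length ≤ m) :
    (filterT f l).time ≤ (t + 1) * m + 1 := by
  refine le_trans ?_ (Nat.add_le_add_right (Nat.mul_le_mul_left _ hl) 1)
  clear hl
  induction l with
  | nil => simp [filterT]
  | cons a l ih =>
    have h1 := hf a (by simp)
    have h2 := ih fun b hb => hf b (by simp [hb])
    simp only [filterT, time_bind, time_charge, time_ite, List.length_cons, ite_self]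
    rw [mul_add, mul_one]
    omega

theorem allT_val {α : Type} (f : α → Timed Bool) (l : List α) :
    (allT f l).val = true ↔ ∀ a ∈ l, (f a).val = true := by
  induction l with
  | nil => simp [allT]
  | cons a l ih => by_cases h : (f a).val <;> simp [allT, ih, h]

theorem allT_time_le {α : Type} {f : α → Timed Bool} {l : List α} {t m : ℕ}
    (hf : ∀ a ∈ l, (f a).time ≤ t) (hl : l.length ≤ m) :
    (allT f l).time ≤ (t + 1) * m + 1 := by
  refine le_trans ?_ (Nat.add_le_add_right (Nat.mul_le_mul_left _ hl) 1)
  clear hl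
  induction l with
  | nil => simp [allT]
  | cons a l ih =>
    have h1 := hf a (by simp)
    have h2 := ih fun b hb => hf b (by simp [hb])
    simp only [allT, time_bind, time_charge, time_ite, List.length_cons]
    rw [mul_add, mul_one]
    split <;> omega

theorem anyT_val {α : Type} (f : α → Timed Bool) (l : List α) :
    (anyT f l).val = true ↔ ∃ a ∈ l, (f a).val = true := by
  induction l with
  | nil => simp [anyT]
  | cons a l ih => by_cases h : (f a).val <;> simp [anyT, ih, h]

theorem anyT_time_le {α : Type} {f : α → Timed Bool} {l : List α} {t m : ℕ}
    (hf : ∀ a ∈ l, (f a).time ≤ t) (hl : l.length ≤ m) :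
    (anyT f l).time ≤ (t + 1) * m + 1 := by
  refine le_trans ?_ (Nat.add_le_add_right (Nat.mul_le_mul_left _ hl) 1)
  clear hl
  induction l with
  | nil => simp [anyT]
  | cons a l ih =>
    have h1 := hf a (by simp)
    have h2 := ih fun b hb => hf b (by simp [hb])
    simp only [anyT, time_bind, time_charge, time_ite, List.length_cons]
    rw [mul_add, mul_one]
    split <;> omega

theorem appendT_val {α : Type} (l m : List α) : (appendT l m).val = l ++ m := by
  induction l with
  | nil => rfl
  | cons a l ih => simp [appendT, ih]

theorem appendT_time {α : Type} (l m : List α) : (appendT l m).time = l.length + 1 := by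
  induction l with
  | nil => rfl
  | cons a l ih => simp [appendT, ih]

theorem concatT_val {α : Type} (ls : List (List α)) : (concatT ls).val = ls.flatten := by
  induction ls with
  | nil => rfl
  | cons a l ih => simp [concatT, ih, appendT_val]

theorem concatT_time {α : Type} (ls : List (List α)) :
    (concatT ls).time = ls.flatten.length + ls.length + 1 := by
  induction ls with
  | nil => rfl
  | cons a l ih =>
    simp only [concatT, time_bind, ih, appendT_time, List.flatten_cons, List.length_append,
      List.length_cons]
    omega

theorem mem_dedupT {α : Type} {eq : α → α → Timed Bool}
    (heq : ∀ a b, (eq a b).val = true ↔ a = b) (l : List α) (x : α) :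
    x ∈ (dedupT eq l).val ↔ x ∈ l := by
  induction l with
  | nil => simp [dedupT]
  | cons a l ih =>
    have hb : (anyT (eq a) (dedupT eq l).val).val = true ↔ a ∈ (dedupT eq l).val := by
      simp [anyT_val, heq]
    simp only [dedupT, val_bind, val_ite, val_charge, hb]
    split
    · rename_i h
      rw [List.mem_cons, ih]
      exact ⟨Or.inr, fun hx => hx.elim (fun hx => ih.1 (hx ▸ hb.1 h)) id⟩
    · simp [ih]

theorem nodup_dedupT {α : Type} {eq : α → α → Timed Bool}
    (heq : ∀ a b, (eq a b).val = true ↔ a = b) (l : List α) : (dedupT eq l).val.Nodup := by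
  induction l with
  | nil => simp [dedupT]
  | cons a l ih =>
    have hb : (anyT (eq a) (dedupT eq l).val).val = true ↔ a ∈ (dedupT eq l).val := by
      simp [anyT_val, heq]
    simp only [dedupT, val_bind, val_ite, val_charge, hb]
    split
    · exact ih
    · rename_i h
      exact List.nodup_cons.2 ⟨mt hb.2 h, ih⟩

theorem dedupT_length_le {α : Type} (eq : α → α → Timed Bool) (l : List α) :
    (dedupT eq l).val.length ≤ l.length := by
  induction l with
  | nil => simp [dedupT]
  | cons a l ih =>
    simp only [dedupT, val_bind, val_ite, val_charge]
    split <;> simp <;> omega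

theorem dedupT_subset {α : Type} (eq : α → α → Timed Bool) (l : List α) :
    (dedupT eq l).val ⊆ l := by
  induction l with
  | nil => simp [dedupT]
  | cons a l ih =>
    simp only [dedupT, val_bind, val_ite, val_charge]
    split
    · exact List.subset_cons_of_subset _ ih
    · exact List.cons_subset_cons _ ih

theorem dedupT_time_le {α : Type} {eq : α → α → Timed Bool} {l : List α} {t m : ℕ}
    (hf : ∀ a ∈ l, ∀ b ∈ l, (eq a b).time ≤ t) (hl : l.length ≤ m) :
    (dedupT eq l).time ≤ ((t + 1) * m + 2) * m + 1 := by
  suffices h : ∀ k ≤ m, l.length = k → (dedupT eq l).time ≤ ((t + 1) * m + 2) * k + 1 from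
    (h _ hl rfl).trans (Nat.add_le_add_right (Nat.mul_le_mul_left _ hl) 1)
  clear hl
  induction l with
  | nil => rintro k - rfl; simp [dedupT]
  | cons a l ih =>
    rintro k hk rfl
    have h2 := ih (fun b hb c hc => hf b (by simp [hb]) c (by simp [hc])) l.length
      (by simp at hk; omega) rfl
    have h3 : (anyT (eq a) (dedupT eq l).val).time ≤ (t + 1) * m + 1 :=
      anyT_time_le (fun b hb => hf a (by simp) b (by simp [dedupT_subset eq l hb]))
        ((dedupT_length_le eq l).trans (by simp at hk; omega))
    simp only [dedupT, time_bind, time_charge, time_ite, List.length_cons, ite_self]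
    rw [mul_add, mul_one]
    omega

theorem mem_shortSublistsT {α : Type} (k : ℕ) (l t : List α) :
    t ∈ (shortSublistsT k l).val ↔ t.Sublist l ∧ t.length ≤ k := by
  induction l generalizing k t with
  | nil => cases k <;> simp +contextual [shortSublistsT]
  | cons a l ih =>
    cases k with
    | zero => simp +contextual [shortSublistsT]
    | succ k =>
      simp only [shortSublistsT, val_bind, appendT_val, mapT_val, val_charge, List.mem_append, ih,
        List.mem_map, List.sublist_cons_iff]
      constructor
      · rintro (⟨h1, h2⟩ | ⟨r, ⟨h1, h2⟩, rfl⟩)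
        · exact ⟨Or.inl h1, h2⟩
        · exact ⟨Or.inr ⟨r, rfl, h1⟩, by simpa using h2⟩
      · rintro ⟨h1 | ⟨r, rfl, h1⟩, h2⟩
        · exact Or.inl ⟨h1, h2⟩
        · exact Or.inr ⟨r, ⟨h1, by simpa using h2⟩, rfl⟩

theorem shortSublistsT_length_le {α : Type} (k : ℕ) (l : List α) :
    (shortSublistsT k l).val.length ≤ (l.length + 1) ^ k := by
  induction l generalizing k with
  | nil => cases k <;> simp [shortSublistsT]
  | cons a l ih =>
    cases k with
    | zero => simp [shortSublistsT]
    | succ k =>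
      simp only [shortSublistsT, val_bind, appendT_val, mapT_val, List.length_append,
        List.length_map, List.length_cons]
      have h1 := ih (k + 1)
      have h2 := ih k
      have h3 : (l.length + 1) ^ k ≤ (l.length + 1 + 1) ^ k := Nat.pow_le_pow_left (by omega) _
      calc _ ≤ (l.length + 1) ^ (k + 1) + (l.length + 1) ^ k := Nat.add_le_add h1 h2
        _ = (l.length + 1 + 1) * (l.length + 1) ^ k := by ring
        _ ≤ (l.length + 1 + 1) * (l.length + 1 + 1) ^ k := Nat.mul_le_mul_left _ h3
        _ = _ := by ring

theorem shortSublistsT_time_le {α : Type} (k : ℕ) (l : List α) :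
    (shortSublistsT k l).time ≤ 5 * (l.length + 1) ^ (k + 1) := by
  induction l generalizing k with
  | nil => cases k <;> simp [shortSublistsT]
  | cons a l ih =>
    cases k with
    | zero => simp [shortSublistsT]; omega
    | succ k =>
      simp only [shortSublistsT, time_bind, appendT_time, List.length_cons]
      have h1 := ih (k + 1)
      have h2 := ih k
      have h3 := shortSublistsT_length_le (k + 1) l
      have h5 := mapT_time_le (f := fun t => charge 1 (a :: t)) (t := 1)
        (l := (shortSublistsT k l).val) (fun _ _ => by simp) (shortSublistsT_length_le k l)
      have h4 : (l.length + 1) ^ k ≤ (l.length + 1) ^ (k + 1) :=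
        Nat.pow_le_pow_right (by omega) (by omega)
      have h6 : 1 ≤ (l.length + 1) ^ (k + 1) := Nat.one_le_pow _ _ (by omega)
      have h7 : (l.length + 1) ^ (k + 1 + 1) + 2 * (l.length + 1) ^ (k + 1)
          ≤ (l.length + 1 + 1) ^ (k + 1 + 1) := by
        have : (l.length + 1) ^ k ≤ (l.length + 1 + 1) ^ k := Nat.pow_le_pow_left (by omega) _
        calc (l.length + 1) ^ (k + 1 + 1) + 2 * (l.length + 1) ^ (k + 1)
            ≤ (l.length + 1) ^ (k + 1 + 1) + 2 * (l.length + 1) ^ (k + 1)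
                + (l.length + 1) ^ k := Nat.le_add_right _ _
          _ = (l.length + 1 + 1) ^ 2 * (l.length + 1) ^ k := by ring
          _ ≤ (l.length + 1 + 1) ^ 2 * (l.length + 1 + 1) ^ k := Nat.mul_le_mul_left _ this
          _ = _ := by ring
      omega

/-! ### Polynomially bounded functions -/

/-- `f` is bounded by a polynomial, in the form in which running times are bounded. -/
def PolyBounded (f : ℕ → ℕ) : Prop := ∃ c κ : ℕ, ∀ m, f m ≤ c * (m + 1) ^ κ

theorem PolyBounded.const (a : ℕ) : PolyBounded fun _ => a := ⟨a, 0, by simp⟩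

theorem PolyBounded.id : PolyBounded fun m => m := ⟨1, 1, by simp⟩

theorem PolyBounded.add {f g : ℕ → ℕ} (hf : PolyBounded f) (hg : PolyBounded g) :
    PolyBounded fun m => f m + g m := by
  obtain ⟨c, κ, h⟩ := hf
  obtain ⟨c', κ', h'⟩ := hg
  refine ⟨c + c', κ + κ', fun m => ?_⟩
  rw [add_mul]
  exact Nat.add_le_add
    ((h m).trans (Nat.mul_le_mul_left _ (Nat.pow_le_pow_right (by omega) (by omega))))
    ((h' m).trans (Nat.mul_le_mul_left _ (Nat.pow_le_pow_right (by omega) (by omega))))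

theorem PolyBounded.mul {f g : ℕ → ℕ} (hf : PolyBounded f) (hg : PolyBounded g) :
    PolyBounded fun m => f m * g m := by
  obtain ⟨c, κ, h⟩ := hf
  obtain ⟨c', κ', h'⟩ := hg
  refine ⟨c * c', κ + κ', fun m => (Nat.mul_le_mul (h m) (h' m)).trans_eq ?_⟩
  ring

theorem PolyBounded.pow {f : ℕ → ℕ} (hf : PolyBounded f) (k : ℕ) :
    PolyBounded fun m => f m ^ k := by
  induction k with
  | zero => simpa using PolyBounded.const 1
  | succ k ih => simpa [pow_succ] using ih.mul hf

theorem PolyBounded.comp {f g : ℕ → ℕ} (hf : PolyBounded f) (hg : PolyBounded g) :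
    PolyBounded fun m => f (g m) := by
  obtain ⟨c, κ, h⟩ := hf
  obtain ⟨c', κ', h'⟩ := ((PolyBounded.const c).mul ((hg.add (.const 1)).pow κ))
  exact ⟨c', κ', fun m => (h _).trans (h' m)⟩

/-! ### Fourier–Motzkin elimination -/

/-- The vector `u` satisfies the constraint `p`. -/
def Constraint.Holds {k : ℕ} (p : Constraint k) (u : Fin k → ℝ) : Prop :=
  (p.strict = true → ∑ i, p.coeff i * u i < 0) ∧ ∑ i, p.coeff i * u i ≤ 0

/-- A real number lies between finitely many lower and upper bounds, some of them strict, as soon as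
each lower bound is compatible with each upper bound. Midway between the largest lower bound and the
smallest upper bound is such a number. -/
theorem exists_between_families {α : Type} (L U : List α) (f : α → ℝ) (s : α → Bool)
    (h : ∀ l ∈ L, ∀ r ∈ U, f l ≤ f r ∧ ((s l || s r) = true → f l < f r)) :
    ∃ t : ℝ, (∀ l ∈ L, f l ≤ t ∧ (s l = true → f l < t)) ∧
      ∀ r ∈ U, t ≤ f r ∧ (s r = true → t < f r) := by
  classical
  rcases L.toFinset.eq_empty_or_nonempty with hL | hL
  · rcases U.toFinset.eq_empty_or_nonempty with hU | hU
    · rw [List.toFinset_eq_empty_iff] at hL hU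
      subst hL hU
      exact ⟨0, by simp, by simp⟩
    · obtain ⟨b, -, hb⟩ := U.toFinset.exists_min_image f hU
      rw [List.toFinset_eq_empty_iff] at hL
      subst hL
      refine ⟨f b - 1, by simp, fun r hr => ?_⟩
      have := hb r (by simpa using hr)
      exact ⟨by linarith, fun _ => by linarith⟩
  · obtain ⟨a, ha', ha⟩ := L.toFinset.exists_max_image f hL
    rcases U.toFinset.eq_empty_or_nonempty with hU | hU
    · rw [List.toFinset_eq_empty_iff] at hU
      subst hU
      refine ⟨f a + 1, fun l hl => ?_, by simp⟩
      have := ha l (by simpa using hl)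
      exact ⟨by linarith, fun _ => by linarith⟩
    · obtain ⟨b, hb', hb⟩ := U.toFinset.exists_min_image f hU
      rw [List.mem_toFinset] at ha' hb'
      refine ⟨(f a + f b) / 2, fun l hl => ?_, fun r hr => ?_⟩
      · have h1 := ha l (by simpa using hl)
        have h2 := h a ha' b hb'
        have h3 := h l hl b hb'
        refine ⟨by linarith, fun hs => ?_⟩
        have := h3.2 (by simp [hs])
        linarith
      · have h1 := hb r (by simpa using hr)
        have h2 := h a ha' b hb'
        have h3 := h a ha' r hr
        refine ⟨by linarith, fun hs => ?_⟩
        have := h3.2 (by simp [hs])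
        linarith

theorem combineT_holds {k : ℕ} (p q : Constraint (k + 1)) (u : Fin k → ℝ) :
    (combineT p q).val.Holds u ↔
      p.coeff 0 * (∑ i : Fin k, q.coeff i.succ * u i)
          ≤ q.coeff 0 * ∑ i : Fin k, p.coeff i.succ * u i ∧
      ((p.strict || q.strict) = true →
        p.coeff 0 * (∑ i : Fin k, q.coeff i.succ * u i)
          < q.coeff 0 * ∑ i : Fin k, p.coeff i.succ * u i) := by
  have h : ∑ i : Fin k, (p.coeff 0 * q.coeff i.succ - q.coeff 0 * p.coeff i.succ) * u i
      = p.coeff 0 * (∑ i : Fin k, q.coeff i.succ * u i)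
        - q.coeff 0 * ∑ i : Fin k, p.coeff i.succ * u i := by
    rw [Finset.mul_sum, Finset.mul_sum, ← Finset.sum_sub_distrib]
    exact Finset.sum_congr rfl fun i _ => by ring
  simp only [combineT, Constraint.Holds, val_bind, val_charge, val_tabulateT, mulT, subT, orT, h,
    sub_neg, sub_nonpos]
  exact and_comm

/-- Fourier–Motzkin elimination decides solvability: the eliminated system says that every lower
bound for the first unknown lies below every upper bound. -/
theorem feasibleT_val (k : ℕ) (cs : List (Constraint k)) :
    (feasibleT k cs).val = true ↔ ∃ u : Fin k → ℝ, ∀ p ∈ cs, p.Holds u := by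
  induction k with
  | zero =>
    simp only [feasibleT, allT_val, notT, val_charge, Constraint.Holds, Finset.univ_eq_empty,
      Finset.sum_empty, lt_irrefl, le_refl, and_true]
    simp
  | succ k ih =>
    simp only [feasibleT, val_bind, ih, appendT_val, concatT_val, mapT_val, filterT_val, ltT, eqT,
      val_charge, List.mem_append, List.mem_map, List.mem_flatten, List.mem_filter,
      decide_eq_true_eq]
    have key : ∀ u : Fin k → ℝ,
        (∀ p : Constraint k, (∃ a, (a ∈ cs ∧ a.coeff 0 = 0) ∧ (dropFirstT a).val = p) ∨
            (∃ l, (∃ a, (a ∈ cs ∧ 0 < a.coeff 0) ∧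
              List.map (fun a_1 => (combineT a a_1).val)
                (List.filter (fun a => decide (a.coeff 0 < 0)) cs) = l) ∧ p ∈ l) → p.Holds u) ↔
          (∀ a ∈ cs, a.coeff 0 = 0 → (dropFirstT a).val.Holds u) ∧
          ∀ p ∈ cs, 0 < p.coeff 0 → ∀ q ∈ cs, q.coeff 0 < 0 → (combineT p q).val.Holds u := by
      intro u
      constructor
      · intro h
        refine ⟨fun a ha h0 => h _ (Or.inl ⟨a, ⟨ha, h0⟩, rfl⟩), fun p hp hp0 q hq hq0 =>
          h _ (Or.inr ⟨_, ⟨p, ⟨hp, hp0⟩, rfl⟩, List.mem_map.2 ⟨q, ?_, rfl⟩⟩)⟩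
        simpa using ⟨hq, hq0⟩
      · rintro ⟨h1, h2⟩ p (⟨a, ⟨ha, h0⟩, rfl⟩ | ⟨l, ⟨a, ⟨ha, h0⟩, rfl⟩, hp⟩)
        · exact h1 a ha h0
        · obtain ⟨q, hq, rfl⟩ := List.mem_map.1 hp
          rw [List.mem_filter, decide_eq_true_eq] at hq
          exact h2 a ha h0 q hq.1 hq.2
    simp only [key]
    have hdrop : ∀ (a : Constraint (k + 1)) (u : Fin k → ℝ), (dropFirstT a).val.Holds u ↔
        (a.strict = true → ∑ i : Fin k, a.coeff i.succ * u i < 0) ∧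
          ∑ i : Fin k, a.coeff i.succ * u i ≤ 0 := fun a u => Iff.rfl
    constructor
    · rintro ⟨u, h0, hpq⟩
      let R : Constraint (k + 1) → ℝ := fun p => ∑ i : Fin k, p.coeff i.succ * u i
      have hR : ∀ p : Constraint (k + 1), ∑ i : Fin k, p.coeff i.succ * u i = R p := fun _ => rfl
      obtain ⟨t, ht1, ht2⟩ := exists_between_families
        (cs.filter fun p => decide (p.coeff 0 < 0)) (cs.filter fun p => decide (0 < p.coeff 0))
        (fun p => -R p / p.coeff 0) (fun p => p.strict) (by
          intro q hq p hp
          simp only [List.mem_filter, decide_eq_true_eq] at hp hq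
          have := (combineT_holds p q u).1 (hpq p hp.1 hp.2 q hq.1 hq.2)
          rw [hR, hR] at this
          have e : -R p / p.coeff 0 - -R q / q.coeff 0
              = (q.coeff 0 * R p - p.coeff 0 * R q) / (-(p.coeff 0 * q.coeff 0)) := by
            have := hp.2.ne'
            have := hq.2.ne
            field_simp
            ring
          have hpos : 0 < -(p.coeff 0 * q.coeff 0) := by nlinarith [hp.2, hq.2]
          constructor
          · rw [← sub_nonneg, e]
            exact div_nonneg (by linarith [this.1]) hpos.le
          · intro hs
            rw [← sub_pos, e]
            exact div_pos (by linarith [this.2 (by rw [Bool.or_comm]; exact hs)]) hpos)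
      refine ⟨Fin.cons t u, fun p hp => ?_⟩
      have hsum : ∑ i, p.coeff i * (Fin.cons t u : Fin (k + 1) → ℝ) i
          = p.coeff 0 * t + R p := by
        simp [Fin.sum_univ_succ, R]
      unfold Constraint.Holds
      rw [hsum]
      rcases lt_trichotomy (p.coeff 0) 0 with h | h | h
      · obtain ⟨h1, h2⟩ := ht1 p (by simpa using ⟨hp, h⟩)
        constructor
        · intro hs
          have := (div_lt_iff_of_neg h).1 (h2 hs)
          linarith
        · have := (div_le_iff_of_neg h).1 h1
          linarith
      · have := (hdrop p u).1 (h0 p hp h)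
        simpa [h] using this
      · obtain ⟨h1, h2⟩ := ht2 p (by simpa using ⟨hp, h⟩)
        constructor
        · intro hs
          have := (lt_div_iff₀ h).1 (h2 hs)
          linarith
        · have := (le_div_iff₀ h).1 h1
          linarith
    · rintro ⟨u, hu⟩
      refine ⟨fun i => u i.succ, fun a ha h0 => ?_, fun p hp hp0 q hq hq0 => ?_⟩
      · have := hu a ha
        rw [hdrop]
        simpa [Constraint.Holds, Fin.sum_univ_succ, h0] using this
      · rw [combineT_holds]
        have h1 := hu p hp
        have h2 := hu q hq
        simp only [Constraint.Holds, Fin.sum_univ_succ] at h1 h2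
        constructor
        · nlinarith [mul_le_mul_of_nonneg_left h2.2 hp0.le, mul_le_mul_of_nonpos_left h1.2 hq0.le]
        · intro hs
          rcases Bool.or_eq_true_iff.1 hs with hs | hs
          · nlinarith [mul_le_mul_of_nonneg_left h2.2 hp0.le,
              mul_lt_mul_of_neg_left (h1.1 hs) hq0]
          · nlinarith [mul_lt_mul_of_pos_left (h2.1 hs) hp0,
              mul_le_mul_of_nonpos_left h1.2 hq0.le]

/-! ### Vertices and faces of polytopes -/

/-- The linear functional with coefficient vector `u`. -/
def functional {d : ℕ} (u : Pt d) : Pt d →L[ℝ] ℝ :=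
  ∑ i, u i • ContinuousLinearMap.proj (R := ℝ) (φ := fun _ : Fin d => ℝ) i

theorem functional_apply {d : ℕ} (u x : Pt d) : functional u x = ∑ i, u i * x i := by
  simp [functional]

theorem exists_functional_eq {d : ℕ} (l : Pt d →L[ℝ] ℝ) : ∃ u, functional u = l := by
  refine ⟨fun i => l (Pi.single i 1), ?_⟩
  ext x
  rw [functional_apply]
  conv_rhs => rw [← Finset.univ_sum_single x, map_sum]
  refine Finset.sum_congr rfl fun i _ => ?_
  have : (Pi.single i (x i) : Pt d) = x i • Pi.single i 1 := by
    rw [← Pi.single_smul]; simp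
  rw [this, map_smul, smul_eq_mul, mul_comm]

theorem finite_setOf_mem {α : Type} (l : List α) : {x | x ∈ l}.Finite := by
  classical
  exact List.finite_toSet l

theorem subset_hullSet {d : ℕ} {l : List (Pt d)} {x : Pt d} (hx : x ∈ l) : x ∈ hullSet l :=
  subset_convexHull ℝ _ hx

theorem isCompact_hullSet {d : ℕ} (l : List (Pt d)) : IsCompact (hullSet l) :=
  (finite_setOf_mem l).isCompact_convexHull ℝ

theorem extremePoints_hullSet_subset {d : ℕ} {l : List (Pt d)} {x : Pt d}
    (hx : x ∈ (hullSet l).extremePoints ℝ) : x ∈ l :=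
  extremePoints_convexHull_subset (A := {x | x ∈ l}) hx

theorem functional_le_of_mem_hullSet {d : ℕ} {l : List (Pt d)} (f : Pt d →L[ℝ] ℝ) {c : ℝ}
    (h : ∀ y ∈ l, f y ≤ c) {x : Pt d} (hx : x ∈ hullSet l) : f x ≤ c :=
  convexHull_min (t := {x | f x ≤ c}) h (convex_halfSpace_le f.isLinear c) hx

/-- A polytope is the convex hull of its vertices. -/
theorem hullSet_vertices {d : ℕ} {l V : List (Pt d)}
    (hV : {x | x ∈ V} = (hullSet l).extremePoints ℝ) : hullSet V = hullSet l := by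
  have h := closure_convexHull_extremePoints (isCompact_hullSet l) (convex_convexHull ℝ _)
  rw [← hV] at h
  rw [← h]
  exact (isCompact_hullSet V).isClosed.closure_eq.symm

/-- The face of a polytope on which a functional is maximal is spanned by those of the given points
at which it is maximal. -/
theorem hullSet_filter_eq {d : ℕ} {V F : List (Pt d)} (f : Pt d →L[ℝ] ℝ) {c : ℝ}
    (hle : ∀ y ∈ V, f y ≤ c) (hF : ∀ x, x ∈ F ↔ x ∈ V ∧ f x = c) (hne : F ≠ []) :
    hullSet F = {x ∈ hullSet V | ∀ y ∈ hullSet V, f y ≤ f x} := by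
  obtain ⟨t, ht⟩ := List.exists_mem_of_ne_nil F hne
  have htV := (hF t).1 ht
  apply Set.Subset.antisymm
  · intro x hx
    have h1 : x ∈ hullSet V := convexHull_mono (fun y hy => ((hF y).1 hy).1) hx
    have h2 : c ≤ f x := convexHull_min (t := {x | c ≤ f x}) (fun y hy => ((hF y).1 hy).2.ge)
      (convex_halfSpace_ge f.isLinear c) hx
    exact ⟨h1, fun y hy => (functional_le_of_mem_hullSet f hle hy).trans h2⟩
  · rintro x ⟨hx, hmax⟩
    have hc : c ≤ f x := htV.2 ▸ hmax t (subset_hullSet htV.1)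
    -- the weights of the points below the maximum vanish
    classical
    have hx' : x ∈ convexHull ℝ ((V.toFinset : Finset (Pt d)) : Set (Pt d)) := by
      simpa [hullSet] using hx
    obtain ⟨w, hw0, hw1, hwx⟩ := Finset.mem_convexHull'.1 hx'
    have hsum : ∑ y ∈ V.toFinset, w y * (c - f y) ≤ 0 := by
      have : f x = ∑ y ∈ V.toFinset, w y * f y := by
        rw [← hwx, map_sum]; simp
      simp only [mul_sub, Finset.sum_sub_distrib, ← Finset.sum_mul, hw1, one_mul, ← this]
      linarith
    have hnn : ∀ y ∈ V.toFinset, 0 ≤ w y * (c - f y) := fun y hy =>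
      mul_nonneg (hw0 y hy) (sub_nonneg.2 (hle y (by simpa using hy)))
    have hz := (Finset.sum_eq_zero_iff_of_nonneg hnn).1 (le_antisymm hsum (Finset.sum_nonneg hnn))
    rw [← hwx]
    have hsub : F.toFinset ⊆ V.toFinset := fun y hy => by
      simp only [List.mem_toFinset] at hy ⊢
      exact ((hF y).1 hy).1
    have hw : ∀ y ∈ V.toFinset, y ∉ F.toFinset → w y = 0 := fun y hy hyF => by
      rcases mul_eq_zero.1 (hz y hy) with h | h
      · exact h
      · exact absurd (List.mem_toFinset.2 ((hF y).2 ⟨by simpa using hy, by linarith⟩)) hyF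
    have e1 : ∑ y ∈ F.toFinset, w y = 1 := by
      rw [← hw1]; exact Finset.sum_subset hsub hw
    have e2 : ∑ y ∈ F.toFinset, w y • y = ∑ y ∈ V.toFinset, w y • y :=
      Finset.sum_subset hsub fun y hy hyF => by rw [hw y hy hyF, zero_smul]
    rw [← e2]
    have : ∑ y ∈ F.toFinset, w y • y ∈ convexHull ℝ ((F.toFinset : Finset (Pt d)) : Set (Pt d)) :=
      Finset.mem_convexHull'.2 ⟨w, fun y hy => hw0 y (hsub hy), e1, rfl⟩
    simpa [hullSet] using this

/-- A point of a finite set is a vertex of its convex hull if and only if it is the unique maximum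
of some linear functional. -/
theorem mem_extremePoints_hullSet_iff {d : ℕ} (l : List (Pt d)) (p : Pt d) :
    p ∈ (hullSet l).extremePoints ℝ ↔
      p ∈ l ∧ ∃ f : Pt d →L[ℝ] ℝ, ∀ x ∈ l, x ≠ p → f x < f p := by
  constructor
  · intro hp
    refine ⟨extremePoints_hullSet_subset hp, ?_⟩
    have h2 := ((convex_convexHull ℝ {x | x ∈ l}).mem_extremePoints_iff_convex_sdiff.1 hp).2
    have hnot : p ∉ convexHull ℝ ({x | x ∈ l} \ {p}) := fun h =>
      (convexHull_min (t := convexHull ℝ {x | x ∈ l} \ {p})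
        (fun x hx => ⟨subset_convexHull ℝ _ hx.1, hx.2⟩) h2 h).2 rfl
    have hcl : IsClosed (convexHull ℝ ({x | x ∈ l} \ {p})) :=
      ((finite_setOf_mem l).sdiff.isCompact_convexHull ℝ).isClosed
    obtain ⟨f, c, hf1, hf2⟩ := geometric_hahn_banach_closed_point (convex_convexHull ℝ _) hcl hnot
    exact ⟨f, fun x hx hxp => (hf1 x (subset_convexHull ℝ _ ⟨hx, hxp⟩)).trans hf2⟩
  · rintro ⟨hp, f, hf⟩
    have hface := hullSet_filter_eq (V := l) (F := [p]) f (c := f p)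
      (fun y hy => by
        rcases eq_or_ne y p with rfl | h
        · exact le_rfl
        · exact (hf y hy h).le)
      (fun x => by
        rw [List.mem_singleton]
        constructor
        · rintro rfl; exact ⟨hp, rfl⟩
        · rintro ⟨hx, he⟩
          by_contra h
          exact (hf x hx h).ne he) (by simp)
    have hexp : IsExposed ℝ (hullSet l) {p} := by
      intro _
      refine ⟨f, ?_⟩
      rw [← hface]
      simp [hullSet]
    exact isExtreme_singleton.1 (hexp.isExtreme)

theorem IsHull.congr {d : ℕ} {l m : List (Pt d)} {H : Hull d} (h : IsHull l H)
    (hlm : hullSet l = hullSet m) : IsHull m H :=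
  ⟨h.1, by rw [← hlm]; exact h.2, by rw [← hlm]; exact h.3, by rw [← hlm]; exact h.4, h.5⟩

/-! ### Correctness of the brute force procedure -/

theorem belowT_holds {d : ℕ} (s : Bool) (x y u : Pt d) :
    (belowT s x y).val.Holds u ↔
      (s = true → functional u x < functional u y) ∧ functional u x ≤ functional u y := by
  have h : ∑ i, (x i - y i) * u i = functional u x - functional u y := by
    simp only [functional_apply, ← Finset.sum_sub_distrib]
    exact Finset.sum_congr rfl fun i _ => by ring
  simp only [belowT, Constraint.Holds, val_bind, val_charge, val_tabulateT, subT, h, sub_neg,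
    sub_nonpos]

theorem ptEqT_val {d : ℕ} (x y : Pt d) : (ptEqT x y).val = true ↔ x = y := by
  simp [ptEqT, allT_val, eqT, funext_iff]

theorem listEqT_val {d : ℕ} (l m : List (Pt d)) : (listEqT l m).val = true ↔ l = m := by
  induction l generalizing m with
  | nil => cases m <;> simp [listEqT]
  | cons x l ih =>
    cases m with
    | nil => simp [listEqT]
    | cons y m =>
      have h := ptEqT_val x y
      by_cases hxy : x = y <;> simp_all [listEqT]

theorem isVertexT_val {d : ℕ} (pts : List (Pt d)) (p : Pt d) :
    (isVertexT pts p).val = true ↔ ∃ f : Pt d →L[ℝ] ℝ, ∀ x ∈ pts, x ≠ p → f x < f p := by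
  have hm : ∀ x, x ∈ (filterT (fun x => do let b ← ptEqT x p; notT b) pts).val ↔
      x ∈ pts ∧ x ≠ p := fun x => by
    simp [filterT_val, notT, ← Bool.not_eq_true, ptEqT_val]
  simp only [isVertexT, val_bind, feasibleT_val, mapT_val, List.mem_map]
  constructor
  · rintro ⟨u, hu⟩
    exact ⟨functional u, fun x hx hxp =>
      ((belowT_holds _ _ _ _).1 (hu _ ⟨x, (hm x).2 ⟨hx, hxp⟩, rfl⟩)).1 rfl⟩
  · rintro ⟨f, hf⟩
    obtain ⟨u, rfl⟩ := exists_functional_eq f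
    refine ⟨u, ?_⟩
    rintro q ⟨x, hx, rfl⟩
    have := hf x ((hm x).1 hx).1 ((hm x).1 hx).2
    exact (belowT_holds _ _ _ _).2 ⟨fun _ => this, this.le⟩

/-- `f` attains its maximum over `V` at all points of `T`. -/
def MaximalOn {d : ℕ} (V T : List (Pt d)) (f : Pt d →L[ℝ] ℝ) : Prop :=
  ∀ t ∈ T, ∀ y ∈ V, f y ≤ f t

theorem onAllFacesT_val {d : ℕ} (V : List (Pt d)) (t₀ : Pt d) (T : List (Pt d)) (x : Pt d) :
    (onAllFacesT V t₀ T x).val = true ↔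
      ∀ f : Pt d →L[ℝ] ℝ, (∀ y ∈ V, f y ≤ f t₀) → (∀ t ∈ T, f t₀ ≤ f t) → f t₀ ≤ f x := by
  simp only [onAllFacesT, val_bind, notT, val_charge, Bool.not_eq_true', ← Bool.not_eq_true,
    feasibleT_val, mapT_val, appendT_val, List.mem_cons, List.mem_append, List.mem_map, not_exists]
  constructor
  · intro h f h1 h2
    obtain ⟨u, rfl⟩ := exists_functional_eq f
    by_contra! hlt
    refine h u ?_
    rintro p (rfl | ⟨y, hy, rfl⟩ | ⟨t, ht, rfl⟩)
    · exact (belowT_holds _ _ _ _).2 ⟨fun _ => hlt, hlt.le⟩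
    · exact (belowT_holds _ _ _ _).2 ⟨by simp, h1 y hy⟩
    · exact (belowT_holds _ _ _ _).2 ⟨by simp, h2 t ht⟩
  · intro h u hu
    refine absurd (h (functional u)
      (fun y hy => ((belowT_holds _ _ _ _).1 (hu _ (Or.inr (Or.inl ⟨y, hy, rfl⟩)))).2)
      (fun t ht => ((belowT_holds _ _ _ _).1 (hu _ (Or.inr (Or.inr ⟨t, ht, rfl⟩)))).2)) ?_
    exact not_le.2 (((belowT_holds _ _ _ _).1 (hu _ (Or.inl rfl))).1 rfl)

/-- The computed smallest face consists of the points of `V` at which every functional maximal on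
`T` is maximal. -/
theorem mem_smallestFaceT {d : ℕ} {V T : List (Pt d)} (hT : T ≠ []) (hTV : T ⊆ V) (x : Pt d) :
    x ∈ (smallestFaceT V T).val ↔ x ∈ V ∧ ∀ f, MaximalOn V T f → MaximalOn V [x] f := by
  obtain ⟨t₀, T, rfl⟩ := List.exists_cons_of_ne_nil hT
  simp only [smallestFaceT, filterT_val, List.mem_filter, onAllFacesT_val]
  refine and_congr_right fun hx => forall_congr' fun f => ?_
  have ht₀ : t₀ ∈ V := hTV (by simp)
  constructor
  · intro h hm t ht y hy
    rw [List.mem_singleton] at ht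
    subst ht
    exact (hm t₀ (by simp) y hy).trans
      (h (hm t₀ (by simp)) fun s hs => hm s (by simp [hs]) t₀ ht₀)
  · intro h h1 h2
    refine h (fun t ht y hy => ?_) x (by simp) t₀ ht₀
    rcases List.mem_cons.1 ht with rfl | ht
    · exact h1 y hy
    · exact (h1 y hy).trans (h2 t ht)

theorem smallestFaceT_sublist {d : ℕ} (V T : List (Pt d)) :
    ((smallestFaceT V T).val).Sublist V := by
  cases T with
  | nil => simp [smallestFaceT]
  | cons t T => simp [smallestFaceT, filterT_val]

/-- Adding up functionals that cut off the individual points outside the smallest face containing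
`T` shows that this set is a face. -/
theorem isExposed_smallestFaceT {d : ℕ} {V T : List (Pt d)} (hT : T ≠ []) (hTV : T ⊆ V) :
    IsExposed ℝ (hullSet V) (hullSet (smallestFaceT V T).val) := by
  classical
  intro _
  set F := (smallestFaceT V T).val with hFdef
  obtain ⟨t, ht⟩ := List.exists_mem_of_ne_nil T hT
  have hF := mem_smallestFaceT hT hTV
  have hcut : ∀ x : Pt d, ∃ f : Pt d →L[ℝ] ℝ, MaximalOn V T f ∧ (x ∈ V → x ∉ F → f x < f t) := by
    intro x
    by_cases hx : x ∈ V ∧ x ∉ F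
    · have := mt (hF x).2 hx.2
      push Not at this
      obtain ⟨f, hf, hfx⟩ := this hx.1
      refine ⟨f, hf, fun _ _ => ?_⟩
      simp only [MaximalOn, List.mem_singleton, forall_eq, not_forall, not_le] at hfx
      obtain ⟨y, hy, hlt⟩ := hfx
      exact hlt.trans_le (hf t ht y hy)
    · exact ⟨0, fun _ _ _ _ => by simp, fun h1 h2 => absurd ⟨h1, h2⟩ hx⟩
  choose f hf hfx using hcut
  let g : Pt d →L[ℝ] ℝ := ∑ x ∈ V.toFinset, f x
  have hg : ∀ y, g y = ∑ x ∈ V.toFinset, f x y := fun y => by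
    simp [g]
  have hle : ∀ y ∈ V, g y ≤ g t := fun y hy => by
    rw [hg, hg]
    exact Finset.sum_le_sum fun x _ => hf x t ht y hy
  have htF : t ∈ F := (hF t).2 ⟨hTV ht, fun f hf s hs y hy => by
    rw [List.mem_singleton] at hs; subst hs; exact hf s ht y hy⟩
  refine ⟨g, hullSet_filter_eq g hle (fun x => ⟨fun hx => ⟨((hF x).1 hx).1, ?_⟩, ?_⟩)
    (List.ne_nil_of_mem htF)⟩
  · have hxV := ((hF x).1 hx).1
    rw [hg, hg]
    exact Finset.sum_congr rfl fun z _ => le_antisymm (hf z t ht x hxV)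
      (((hF x).1 hx).2 (f z) (hf z) x (by simp) t (hTV ht))
  · rintro ⟨hxV, hxt⟩
    by_contra hxF
    have : g x < g t := by
      rw [hg, hg]
      exact Finset.sum_lt_sum (fun z _ => hf z t ht x hxV)
        ⟨x, by simpa using hxV, hfx x hxV hxF⟩
    exact this.ne hxt

/-- Every nonempty face is the smallest face containing an affine basis of it. -/
theorem exists_seed {d : ℕ} {V : List (Pt d)} (hV : V.Nodup) {B : Set (Pt d)} (hB : B.Nonempty)
    (hexp : IsExposed ℝ (hullSet V) B) :
    ∃ T, T ≠ [] ∧ T.Sublist V ∧ T.length ≤ d + 1 ∧ hullSet (smallestFaceT V T).val = B := by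
  classical
  obtain ⟨f, hf⟩ := hexp hB
  obtain ⟨b, hb⟩ := hB
  have hVne : V ≠ [] := by
    rintro rfl
    rw [hf] at hb
    simpa [hullSet] using hb.1
  obtain ⟨t, ht, hmax⟩ := V.toFinset.exists_max_image f
    (List.toFinset_nonempty_iff V |>.2 hVne)
  simp only [List.mem_toFinset] at ht hmax
  set W := V.filter fun x => decide (f x = f t) with hW
  have hWm : ∀ x, x ∈ W ↔ x ∈ V ∧ f x = f t := fun x => by simp [hW]
  have hWne : W ≠ [] := List.ne_nil_of_mem ((hWm t).2 ⟨ht, rfl⟩)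
  have hWB : hullSet W = B := by rw [hf]; exact hullSet_filter_eq f hmax hWm hWne
  obtain ⟨s, hsW, hspan, hind⟩ := exists_affineIndependent ℝ (Pt d) {x | x ∈ W}
  have hsfin : s.Finite := (finite_setOf_mem W).subset hsW
  have : Fintype s := hsfin.fintype
  set T := V.filter fun x => decide (x ∈ s) with hTdef
  have hTm : ∀ x, x ∈ T ↔ x ∈ s := fun x => by
    simp only [hTdef, List.mem_filter, decide_eq_true_eq, and_iff_right_iff_imp]
    exact fun hx => ((hWm x).1 (hsW hx)).1
  have hsne : s.Nonempty := by
    rw [← affineSpan_nonempty ℝ, hspan, affineSpan_nonempty]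
    exact ⟨t, (hWm t).2 ⟨ht, rfl⟩⟩
  have hTne : T ≠ [] := by
    obtain ⟨x, hx⟩ := hsne
    exact List.ne_nil_of_mem ((hTm x).2 hx)
  have hTV : T.Sublist V := List.filter_sublist
  have hlen : T.length ≤ d + 1 := by
    have h1 : Fintype.card s ≤ _ := hind.card_le_finrank_succ
    have h2 : T.length = Fintype.card s := by
      rw [← List.toFinset_card_of_nodup (hV.filter _), ← Set.toFinset_card]
      congr 1
      ext x
      rw [List.mem_toFinset, Set.mem_toFinset, hTm]
    rw [h2]
    refine h1.trans (Nat.add_le_add_right ?_ 1)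
    exact (Submodule.finrank_le _).trans_eq (by simp)
  refine ⟨T, hTne, hTV, hlen, ?_⟩
  rw [← hWB]
  have hmem : ∀ x, x ∈ (smallestFaceT V T).val ↔ x ∈ W := by
    intro x
    rw [mem_smallestFaceT hTne hTV.subset, hWm]
    refine and_congr_right fun hx => ⟨fun h => ?_, fun hxt g hg => ?_⟩
    · refine le_antisymm (hmax x hx) (h f (fun z hz y hy => ?_) x (by simp) t ht)
      rw [((hWm z).1 (hsW ((hTm z).1 hz))).2]
      exact hmax y hy
    · -- a functional maximal on an affine basis of the face is constant on the face
      obtain ⟨z, hz⟩ := hsne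
      have hconst : ∀ y ∈ s, g y = g z := fun y hy => le_antisymm
        (hg z ((hTm z).2 hz) y (hTV.subset ((hTm y).2 hy)))
        (hg y ((hTm y).2 hy) z (hTV.subset ((hTm z).2 hz)))
      have hxs : x ∈ affineSpan ℝ s := by
        rw [hspan]
        exact subset_affineSpan ℝ _ ((hWm x).2 ⟨hx, hxt⟩)
      have hxz : g x = g z := by
        have : Set.EqOn g.toLinearMap.toAffineMap (AffineMap.const ℝ (Pt d) (g z)) s := hconst
        have := AffineMap.eqOn_affineSpan this
        exact this hxs
      intro w hw y hy
      rw [List.mem_singleton] at hw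
      rw [hw, hxz]
      exact hg z ((hTm z).2 hz) y hy
  have : {x | x ∈ (smallestFaceT V T).val} = {x | x ∈ W} := Set.ext hmem
  simp only [hullSet, this]

theorem bruteForceHull_computesHull (d : ℕ) : ComputesHull (bruteForceHull (d := d)) := by
  intro pts
  simp only [bruteForceHull, val_bind, val_charge]
  set D := (dedupT ptEqT pts).val with hD
  set V := (filterT (isVertexT D) D).val with hVdef
  set faces := (dedupT listEqT (filterT (fun F => charge 1 (!F.isEmpty))
    (mapT (smallestFaceT V) (shortSublistsT (d + 1) V).val).val).val).val with hfaces
  have hVnd : V.Nodup := by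
    rw [hVdef, filterT_val]
    exact (nodup_dedupT ptEqT_val pts).filter _
  have hDpts : hullSet D = hullSet pts := by
    have : {x | x ∈ D} = {x | x ∈ pts} := Set.ext fun x => mem_dedupT ptEqT_val pts x
    simp only [hullSet, this]
  have hVext : {x | x ∈ V} = (hullSet pts).extremePoints ℝ := by
    ext x
    rw [← hDpts, mem_extremePoints_hullSet_iff, Set.mem_ofPred_eq, hVdef, filterT_val,
      List.mem_filter, isVertexT_val]
  have hVpts : hullSet V = hullSet pts := hullSet_vertices hVext
  have hmem : ∀ F, F ∈ faces ↔
      (∃ T, (T.Sublist V ∧ T.length ≤ d + 1) ∧ (smallestFaceT V T).val = F) ∧ F ≠ [] := by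
    intro F
    simp only [hfaces, mem_dedupT listEqT_val, filterT_val, mapT_val, List.mem_filter,
      List.mem_map, mem_shortSublistsT, val_charge]
    simp
  have hTne : ∀ T, (smallestFaceT V T).val ≠ [] → T ≠ [] := by
    rintro T h rfl
    simp [smallestFaceT] at h
  refine ⟨hVnd, hVext, ?_, ?_, ?_⟩
  · intro F hF
    obtain ⟨⟨T, ⟨hTV, -⟩, rfl⟩, hne⟩ := (hmem F).1 hF
    refine ⟨hne, hVnd.sublist (smallestFaceT_sublist V T),
      fun x hx => (smallestFaceT_sublist V T).subset hx, ?_⟩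
    rw [← hVpts]
    exact isExposed_smallestFaceT (hTne T hne) hTV.subset
  · intro B hB hexp
    rw [← hVpts] at hexp
    obtain ⟨T, hT, hTV, hlen, rfl⟩ := exists_seed hVnd hB hexp
    refine ⟨_, (hmem _).2 ⟨⟨T, ⟨hTV, hlen⟩, rfl⟩, ?_⟩, rfl⟩
    intro h
    rw [h] at hB
    simp [hullSet] at hB
  · have hnd : faces.Nodup := nodup_dedupT listEqT_val _
    refine hnd.imp_of_mem fun {F G} hF hG hne heq => hne ?_
    obtain ⟨⟨T, ⟨hTV, -⟩, rfl⟩, hF0⟩ := (hmem F).1 hF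
    obtain ⟨⟨T', ⟨hTV', -⟩, rfl⟩, hG0⟩ := (hmem G).1 hG
    -- vertices of the whole polytope that lie in a face are among the points spanning the face
    have hsub : ∀ {F G : List (Pt d)}, F ⊆ V → G ⊆ V → hullSet F = hullSet G → F ⊆ G := by
      intro F G hF hG h x hx
      have hxe : x ∈ (hullSet pts).extremePoints ℝ := hVext ▸ hF hx
      refine extremePoints_hullSet_subset (inter_extremePoints_subset_extremePoints_of_subset
        ?_ ⟨h ▸ subset_hullSet hx, hxe⟩)
      rw [← hVpts]
      exact convexHull_mono fun y hy => hG hy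
    have s1 := smallestFaceT_sublist V T
    have s2 := smallestFaceT_sublist V T'
    have e1 := hsub s1.subset s2.subset heq
    have e2 := hsub s2.subset s1.subset heq.symm
    cases T with
    | nil => simp [smallestFaceT] at hF0
    | cons t T =>
      cases T' with
      | nil => simp [smallestFaceT] at hG0
      | cons t' T' =>
        simp only [smallestFaceT, filterT_val] at e1 e2 ⊢
        refine List.filter_congr fun x hx => ?_
        have h1 := @e1 x
        have h2 := @e2 x
        simp only [List.mem_filter, hx, true_and] at h1 h2
        exact Bool.eq_iff_iff.2 ⟨h1, h2⟩

/-! ### Running time of the brute force procedure -/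

theorem combineT_time {k : ℕ} (p q : Constraint (k + 1)) : (combineT p q).time = 4 * k + 3 := by
  simp [combineT, mulT, subT, orT]
  omega

theorem dropFirstT_time {k : ℕ} (p : Constraint (k + 1)) : (dropFirstT p).time = 2 * k + 2 := by
  simp [dropFirstT]
  omega

theorem belowT_time {d : ℕ} (s : Bool) (x y : Pt d) : (belowT s x y).time = 2 * d + 2 := by
  simp [belowT, subT]
  omega

theorem ptEqT_time_le {d : ℕ} (x y : Pt d) : (ptEqT x y).time ≤ 2 * d + 1 :=
  allT_time_le (t := 1) (fun i _ => by simp [eqT]) (by simp)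

theorem listEqT_time_le {d m : ℕ} {l : List (Pt d)} (l' : List (Pt d)) (hl : l.length ≤ m) :
    (listEqT l l').time ≤ (2 * d + 1) * m + 1 := by
  refine le_trans ?_ (Nat.add_le_add_right (Nat.mul_le_mul_left _ hl) 1)
  clear hl
  induction l generalizing l' with
  | nil => cases l' <;> simp [listEqT]
  | cons x l ih =>
    cases l' with
    | nil => simp [listEqT]
    | cons y l' =>
      have h1 := ptEqT_time_le x y
      have h2 := ih l'
      simp only [listEqT, time_bind, time_ite, time_charge, List.length_cons]
      rw [mul_add, mul_one]
      split <;> omega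

/-- One elimination step at most squares the size of the system, up to lower order terms, so for a
fixed number of unknowns the elimination is polynomial. -/
theorem feasibleT_time_le (k : ℕ) : ∃ f, PolyBounded f ∧
    ∀ m (cs : List (Constraint k)), cs.length ≤ m → (feasibleT k cs).time ≤ f m := by
  induction k with
  | zero =>
    refine ⟨fun m => (1 + 1) * m + 1, ((PolyBounded.const _).mul .id).add (.const _),
      fun m cs hcs => ?_⟩
    exact allT_time_le (fun p _ => by simp [notT]) hcs
  | succ k ih =>
    obtain ⟨f, hf, hft⟩ := ih
    refine ⟨fun m => 3 * ((1 + 1) * m + 1) + ((2 * k + 2 + 1) * m + 1)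
      + (((4 * k + 3 + 1) * m + 1 + 1) * m + 1) + (m * m + m + 1) + (m + 1) + f (m + m * m),
      ?_, fun m cs hcs => ?_⟩
    · refine PolyBounded.add ?_ (hf.comp (PolyBounded.id.add (PolyBounded.id.mul .id)))
      repeat' first
        | exact PolyBounded.const _
        | exact PolyBounded.id
        | apply PolyBounded.add
        | apply PolyBounded.mul
    · simp only [feasibleT, time_bind]
      set pos := filterT (fun p : Constraint (k + 1) => ltT 0 (p.coeff 0)) cs with hpos
      set neg := filterT (fun p : Constraint (k + 1) => ltT (p.coeff 0) 0) cs with hneg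
      set zero := filterT (fun p : Constraint (k + 1) => eqT (p.coeff 0) 0) cs with hzero
      have l1 : pos.val.length ≤ m := by
        rw [hpos, filterT_val]; exact (List.length_filter_le _ _).trans hcs
      have l2 : neg.val.length ≤ m := by
        rw [hneg, filterT_val]; exact (List.length_filter_le _ _).trans hcs
      have l3 : zero.val.length ≤ m := by
        rw [hzero, filterT_val]; exact (List.length_filter_le _ _).trans hcs
      have t1 : pos.time ≤ (1 + 1) * m + 1 := filterT_time_le (fun _ _ => by simp [ltT]) hcs
      have t2 : neg.time ≤ (1 + 1) * m + 1 := filterT_time_le (fun _ _ => by simp [ltT]) hcs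
      have t3 : zero.time ≤ (1 + 1) * m + 1 := filterT_time_le (fun _ _ => by simp [eqT]) hcs
      have t4 : (mapT dropFirstT zero.val).time ≤ (2 * k + 2 + 1) * m + 1 :=
        mapT_time_le (fun p _ => (dropFirstT_time p).le) l3
      have t5 : (mapT (fun p => mapT (combineT p) neg.val) pos.val).time
          ≤ ((4 * k + 3 + 1) * m + 1 + 1) * m + 1 :=
        mapT_time_le (fun p _ => mapT_time_le (fun q _ => (combineT_time p q).le) l2) l1
      have l4 : (mapT (fun p => mapT (combineT p) neg.val) pos.val).val.flatten.length
          ≤ m * m := by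
        have : (mapT (fun p => mapT (combineT p) neg.val) pos.val).val.flatten.length
            = pos.val.length * neg.val.length := by
          simp [mapT_val, List.length_flatten, Function.comp_def]
        rw [this]
        exact Nat.mul_le_mul l1 l2
      have l5 : (mapT (fun p => mapT (combineT p) neg.val) pos.val).val.length ≤ m := by
        simpa [mapT_val] using l1
      have l6 : (mapT dropFirstT zero.val).val.length ≤ m := by
        simpa [mapT_val] using l3
      have t6 := concatT_time (mapT (fun p => mapT (combineT p) neg.val) pos.val).val
      have t7 := appendT_time (mapT dropFirstT zero.val).val
        (concatT (mapT (fun p => mapT (combineT p) neg.val) pos.val).val).val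
      have t8 := hft (m + m * m) (appendT (mapT dropFirstT zero.val).val
        (concatT (mapT (fun p => mapT (combineT p) neg.val) pos.val).val).val).val (by
          rw [appendT_val, concatT_val, List.length_append]
          exact Nat.add_le_add l6 l4)
      omega

theorem isVertexT_time_le (d : ℕ) : ∃ f, PolyBounded f ∧
    ∀ m (pts : List (Pt d)) (p : Pt d), pts.length ≤ m → (isVertexT pts p).time ≤ f m := by
  obtain ⟨f, hf, hft⟩ := feasibleT_time_le d
  refine ⟨fun m => ((2 * d + 2 + 1) * m + 1) + ((2 * d + 2 + 1) * m + 1) + f m, ?_,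
    fun m pts p hpts => ?_⟩
  · refine PolyBounded.add ?_ hf
    repeat' first
      | exact PolyBounded.const _
      | exact PolyBounded.id
      | apply PolyBounded.add
      | apply PolyBounded.mul
  · simp only [isVertexT, time_bind]
    set others := filterT (fun x => do let b ← ptEqT x p; notT b) pts with ho
    have l1 : others.val.length ≤ m := by
      rw [ho, filterT_val]; exact (List.length_filter_le _ _).trans hpts
    have t1 : others.time ≤ (2 * d + 2 + 1) * m + 1 :=
      filterT_time_le (fun x _ => by simpa [notT] using ptEqT_time_le x p) hpts
    have t2 : (mapT (fun x => belowT true x p) others.val).time ≤ (2 * d + 2 + 1) * m + 1 :=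
      mapT_time_le (fun x _ => (belowT_time _ x p).le) l1
    have t3 := hft m (mapT (fun x => belowT true x p) others.val).val (by simpa [mapT_val] using l1)
    omega

theorem smallestFaceT_time_le (d : ℕ) : ∃ f, PolyBounded f ∧
    ∀ m (V T : List (Pt d)), V.length ≤ m → T.length ≤ d + 1 → (smallestFaceT V T).time ≤ f m := by
  obtain ⟨f, hf, hft⟩ := feasibleT_time_le d
  refine ⟨fun m => (((2 * d + 2 + 1) * m + 1) + ((2 * d + 2 + 1) * (d + 1) + 1) + (m + 1)
    + (2 * d + 2) + f (1 + (m + (d + 1))) + 1 + 1) * m + 1, ?_, fun m V T hV hT => ?_⟩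
  · have := hf.comp ((PolyBounded.const 1).add (PolyBounded.id.add (.const (d + 1))))
    repeat' first
      | exact PolyBounded.const _
      | exact PolyBounded.id
      | exact this
      | apply PolyBounded.add
      | apply PolyBounded.mul
  · cases T with
    | nil => simp [smallestFaceT]
    | cons t₀ T =>
      refine filterT_time_le (fun x _ => ?_) hV
      have hT' : T.length ≤ d + 1 := by simp at hT; omega
      simp only [onAllFacesT, time_bind, notT, time_charge, belowT_time, appendT_time]
      have t1 : (mapT (fun y => belowT false y t₀) V).time ≤ (2 * d + 2 + 1) * m + 1 :=
        mapT_time_le (fun x _ => (belowT_time _ x t₀).le) hV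
      have t2 : (mapT (fun t => belowT false t₀ t) T).time ≤ (2 * d + 2 + 1) * (d + 1) + 1 :=
        mapT_time_le (fun x _ => (belowT_time _ t₀ x).le) hT'
      have l1 : (mapT (fun y => belowT false y t₀) V).val.length ≤ m := by simpa [mapT_val] using hV
      have t3 := hft (1 + (m + (d + 1))) ((belowT true x t₀).val ::
        (appendT (mapT (fun y => belowT false y t₀) V).val
          (mapT (fun t => belowT false t₀ t) T).val).val) (by
          simp only [appendT_val, mapT_val, List.length_cons, List.length_append, List.length_map]
          omega)
      omega

theorem bruteForceHull_runsInTime (d : ℕ) :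
    ∃ c κ, RunsInTime (bruteForceHull (d := d)) c κ := by
  obtain ⟨f, hf, hft⟩ := isVertexT_time_le d
  obtain ⟨g, hg, hgt⟩ := smallestFaceT_time_le d
  suffices h : ∃ F, PolyBounded F ∧ ∀ pts : List (Pt d), (bruteForceHull pts).time ≤ F pts.length by
    obtain ⟨F, ⟨c, κ, hF⟩, h⟩ := h
    exact ⟨c, κ, fun pts => (h pts).trans (hF _)⟩
  refine ⟨fun m => (((2 * d + 1 + 1) * m + 2) * m + 1) + ((f m + 1) * m + 1)
    + 5 * (m + 1) ^ (d + 1 + 1) + ((g m + 1) * (m + 1) ^ (d + 1) + 1)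
    + ((1 + 1) * (m + 1) ^ (d + 1) + 1)
    + (((((2 * d + 1) * m + 1) + 1) * (m + 1) ^ (d + 1) + 2) * (m + 1) ^ (d + 1) + 1) + 1, ?_,
    fun pts => ?_⟩
  · repeat' first
      | exact PolyBounded.const _
      | exact PolyBounded.id
      | exact hf
      | exact hg
      | apply PolyBounded.add
      | apply PolyBounded.mul
      | apply PolyBounded.pow
  · simp only [bruteForceHull, time_bind, time_charge]
    set m := pts.length with hm
    set D := dedupT ptEqT pts with hD
    have lD : D.val.length ≤ m := dedupT_length_le _ _
    set V := filterT (isVertexT D.val) D.val with hVdef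
    have lV : V.val.length ≤ m := by
      rw [hVdef, filterT_val]; exact (List.length_filter_le _ _).trans lD
    set seeds := shortSublistsT (d + 1) V.val with hseeds
    have lS : seeds.val.length ≤ (m + 1) ^ (d + 1) :=
      (shortSublistsT_length_le _ _).trans (Nat.pow_le_pow_left (by omega) _)
    set cands := mapT (smallestFaceT V.val) seeds.val with hcands
    have lC : cands.val.length ≤ (m + 1) ^ (d + 1) := by simpa [hcands, mapT_val] using lS
    set ne := filterT (fun F : List (Pt d) => charge 1 (!F.isEmpty)) cands.val with hne
    have lN : ne.val.length ≤ (m + 1) ^ (d + 1) := by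
      rw [hne, filterT_val]; exact (List.length_filter_le _ _).trans lC
    have t1 : D.time ≤ ((2 * d + 1 + 1) * m + 2) * m + 1 :=
      dedupT_time_le (fun x _ y _ => ptEqT_time_le x y) le_rfl
    have t2 : V.time ≤ (f m + 1) * m + 1 := filterT_time_le (fun x _ => hft m _ _ lD) lD
    have t3 : seeds.time ≤ 5 * (m + 1) ^ (d + 1 + 1) :=
      (shortSublistsT_time_le _ _).trans
        (Nat.mul_le_mul_left _ (Nat.pow_le_pow_left (by omega) _))
    have t4 : cands.time ≤ (g m + 1) * (m + 1) ^ (d + 1) + 1 :=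
      mapT_time_le (fun T hT => hgt m _ _ lV ((mem_shortSublistsT _ _ _).1 hT).2) lS
    have t5 : ne.time ≤ (1 + 1) * (m + 1) ^ (d + 1) + 1 :=
      filterT_time_le (fun _ _ => by simp) lC
    have t6 : (dedupT listEqT ne.val).time
        ≤ ((((2 * d + 1) * m + 1) + 1) * (m + 1) ^ (d + 1) + 2) * (m + 1) ^ (d + 1) + 1 := by
      refine dedupT_time_le (fun F hF G _ => listEqT_time_le G ?_) lN
      rw [hne, filterT_val] at hF
      have := List.mem_of_mem_filter hF
      rw [hcands, mapT_val, List.mem_map] at this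
      obtain ⟨T, -, rfl⟩ := this
      exact (smallestFaceT_sublist _ T).length_le.trans lV
    omega

/-! ### Cells of the quadtree -/

/-- `p` is stored in the subtree of height `k` below the cell `c`, in a tree with `w` leaf cells
along each axis. -/
def InCell {d : ℕ} (w k : ℕ) (c : Fin d → ℕ) (p : Pt d) : Prop :=
  ∀ j, min ⌊p j * w⌋₊ (w - 1) / 2 ^ k = c j

theorem cellOfT_val {d : ℕ} (w : ℕ) (p : Pt d) :
    (cellOfT w p).val = fun j => min ⌊p j * w⌋₊ (w - 1) := rfl

theorem cellOfT_eq_iff {d : ℕ} (w : ℕ) (p : Pt d) (c : Fin d → ℕ) :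
    (cellOfT w p).val = c ↔ InCell w 0 c p := by
  simp [cellOfT_val, InCell, funext_iff]

theorem childCellT_val {d : ℕ} (c : Fin d → ℕ) (b : Fin (2 ^ d)) :
    (childCellT c b).val = fun j => 2 * c j + ((b : ℕ).testBit j).toNat := by
  funext j
  cases h : (b : ℕ).testBit j <;> simp [childCellT, natMulT, testBitT, natAddT, h]

theorem inCell_succ_iff {d : ℕ} (w k : ℕ) (c : Fin d → ℕ) (p : Pt d) :
    InCell w (k + 1) c p ↔ ∃ b, InCell w k (childCellT c b).val p := by
  simp only [InCell, childCellT_val, pow_succ, ← Nat.div_div_eq_div_mul]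
  set m : Fin d → ℕ := fun j => min ⌊p j * w⌋₊ (w - 1) / 2 ^ k with hm
  have hmj : ∀ j, min ⌊p j * w⌋₊ (w - 1) / 2 ^ k = m j := fun _ => rfl
  simp only [hmj]
  constructor
  · intro h
    refine ⟨⟨Nat.ofBits fun j => (m j).testBit 0, Nat.ofBits_lt_two_pow _⟩, fun j => ?_⟩
    rw [← h j, Nat.testBit_ofBits_lt _ _ j.2, Nat.testBit_zero]
    rcases Nat.mod_two_eq_zero_or_one (m j) with h | h
    · simp [h]; omega
    · simp [h]; omega
  · rintro ⟨b, h⟩ j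
    rw [h j]
    cases (b : ℕ).testBit j
    · simp
    · simp; omega

theorem inCell_root {d : ℕ} (h : ℕ) (p : Pt d) : InCell (2 ^ h) h 0 p := by
  intro j
  have : 0 < 2 ^ h := by positivity
  exact Nat.div_eq_of_lt (lt_of_le_of_lt (min_le_right _ _) (by omega))

theorem fillGridT_val {d : ℕ} (w : ℕ) (ps : List (Pt d)) (g : Grid d) (c : Fin d → ℕ) :
    (fillGridT w ps g).val c
      = (ps.filter fun p => decide ((cellOfT w p).val = c)).reverse ++ g c := by
  induction ps generalizing g with
  | nil => simp [fillGridT]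
  | cons p ps ih =>
    simp only [fillGridT, val_bind, ih, readT, writeT, val_charge, List.filter_cons]
    by_cases h : (cellOfT w p).val = c
    · subst h; simp
    · simp [h, Function.update_of_ne (Ne.symm h)]

/-! ### Correctness of the quadtree algorithm -/

/-- The set of points stored in a quadtree. -/
def QuadTree.points {d : ℕ} : QuadTree d → Set (Pt d)
  | .leaf l => {x | x ∈ l}
  | .node children => ⋃ b, (children b).points

theorem points_buildTreeT {d : ℕ} {g : Grid d} {w : ℕ} {pts : List (Pt d)}
    (hg : ∀ c x, x ∈ g c ↔ x ∈ pts ∧ InCell w 0 c x) (k : ℕ) (c : Fin d → ℕ) :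
    (buildTreeT g k c).val.points = {x | x ∈ pts ∧ InCell w k c x} := by
  induction k generalizing c with
  | zero =>
    ext x
    exact hg c x
  | succ k ih =>
    ext x
    simp only [buildTreeT, val_bind, val_charge, val_tabulateT, QuadTree.points, ih,
      Set.mem_iUnion, Set.mem_ofPred_eq, inCell_succ_iff, exists_and_left]

theorem concatT_mapT_val {d k : ℕ} (hulls : Fin k → Hull d) :
    (concatT (mapT (fun b => charge 1 (hulls b).vertices) (List.finRange k)).val).val
      = ((List.finRange k).map fun b => (hulls b).vertices).flatten := by
  simp [concatT_val, mapT_val]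

theorem isHull_traverseT {d : ℕ} {leafHull mergeHull : List (Pt d) → Timed (Hull d)}
    (hl : ComputesHull leafHull) (hm : ComputesHull mergeHull) (t : QuadTree d) (l : List (Pt d))
    (h : {x | x ∈ l} = t.points) : IsHull l (traverseT leafHull mergeHull t).val := by
  classical
  induction t generalizing l with
  | leaf pts =>
    refine (hl pts).congr ?_
    simp only [hullSet, h]
    rfl
  | node ch ih =>
    simp only [traverseT, val_bind, val_tabulateT]
    refine (hm _).congr ?_
    rw [concatT_mapT_val]
    -- the points of each child, as a list
    let part : Fin (2 ^ d) → List (Pt d) := fun b => l.filter fun x => decide (x ∈ (ch b).points)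
    have hpart : ∀ b, {x | x ∈ part b} = (ch b).points := fun b => by
      ext x
      simp only [part, List.mem_filter, decide_eq_true_eq, Set.mem_ofPred_eq, and_iff_right_iff_imp]
      intro hx
      have : x ∈ {x | x ∈ l} := by
        rw [h]; exact Set.mem_iUnion.2 ⟨b, hx⟩
      exact this
    have hv : ∀ b, hullSet (traverseT leafHull mergeHull (ch b)).val.vertices = hullSet (part b) :=
      fun b => hullSet_vertices (ih b (part b) (hpart b)).vertices_eq
    apply Set.Subset.antisymm
    · refine convexHull_min (fun x hx => ?_) (convex_convexHull ℝ _)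
      simp only [List.mem_flatten, List.mem_map, List.mem_finRange, true_and,
        Set.mem_ofPred_eq] at hx
      obtain ⟨_, ⟨b, rfl⟩, hx⟩ := hx
      have hx' := subset_hullSet hx
      rw [hv] at hx'
      exact convexHull_mono (fun y hy => (List.mem_filter.1 hy).1) hx'
    · refine convexHull_min (fun x hx => ?_) (convex_convexHull ℝ _)
      have hx' : x ∈ {x | x ∈ l} := hx
      rw [h] at hx'
      obtain ⟨b, hb⟩ := Set.mem_iUnion.1 hx'
      have hxb : x ∈ hullSet (part b) := subset_hullSet (by
        have : x ∈ {x | x ∈ part b} := by rw [hpart]; exact hb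
        exact this)
      rw [← hv] at hxb
      refine convexHull_mono (fun y hy => ?_) hxb
      simp only [List.mem_flatten, List.mem_map, List.mem_finRange, true_and, Set.mem_ofPred_eq]
      exact ⟨_, ⟨b, rfl⟩, hy⟩

theorem heightT_val_clog (d n : ℕ) (hd : 1 ≤ d) :
    (heightT d n).val = (Nat.clog (2 ^ d) n, 2 ^ Nat.clog (2 ^ d) n) := by
  have hb : 2 ≤ 2 ^ d := by
    calc 2 = 2 ^ 1 := rfl
      _ ≤ 2 ^ d := Nat.pow_le_pow_right (by norm_num) hd
  have hle : Nat.clog (2 ^ d) n ≤ n := (Nat.clog_le_iff_le_pow hb).2 (Nat.lt_pow_self hb).le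
  simpa [heightT, powTwoT_val] using
    heightLoopT_val (2 ^ d) n hb n 0 (Nat.zero_le _) (by simpa using hle)

/-- The grid of leaf cells, of side length `w`, that stores the points of `pts`. -/
def leafGrid {d : ℕ} (w : ℕ) (pts : List (Pt d)) : Grid d := (fillGridT w pts fun _ => []).val

theorem leafGrid_apply {d : ℕ} (w : ℕ) (pts : List (Pt d)) (c : Fin d → ℕ) :
    leafGrid w pts c = (pts.filter fun p => decide ((cellOfT w p).val = c)).reverse := by
  simp [leafGrid, fillGridT_val]

theorem mem_leafGrid {d : ℕ} (w : ℕ) (pts : List (Pt d)) (c : Fin d → ℕ) (x : Pt d) :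
    x ∈ leafGrid w pts c ↔ x ∈ pts ∧ InCell w 0 c x := by
  simp [leafGrid_apply, cellOfT_eq_iff]

theorem quadTreeT_val {d : ℕ} (hd : 1 ≤ d) (pts : List (Pt d)) :
    (quadTreeT pts).val = (buildTreeT (leafGrid (2 ^ Nat.clog (2 ^ d) pts.length) pts)
      (Nat.clog (2 ^ d) pts.length) 0).val := by
  simp only [quadTreeT, val_bind, lengthT_val, heightT_val_clog d _ hd, newGridT, val_charge,
    val_tabulateT]
  rfl

theorem quadtreeHull_computesHull {d : ℕ} (hd : 1 ≤ d)
    {leafHull mergeHull : List (Pt d) → Timed (Hull d)}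
    (hl : ComputesHull leafHull) (hm : ComputesHull mergeHull) :
    ComputesHull (quadtreeHull leafHull mergeHull) := by
  intro pts
  simp only [quadtreeHull, val_bind, quadTreeT_val hd]
  refine isHull_traverseT hl hm _ _ ?_
  rw [points_buildTreeT (mem_leafGrid _ pts)]
  ext x
  simp [inCell_root]

/-! ### Running time in terms of the numbers of points and vertices -/

theorem heightLoopT_time_le (b n fuel h w t : ℕ) :
    (heightLoopT b n fuel h w t).time ≤ 4 * fuel + 1 := by
  induction fuel generalizing h w t with
  | zero => simp [heightLoopT]
  | succ f ih =>
    have := ih (h + 1) (2 * w) (b * t)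
    by_cases hlt : t < n <;>
      simp only [heightLoopT, time_bind, natLtT, natAddT, natMulT, val_charge, time_charge, hlt,
        decide_true, decide_false, if_true, Bool.false_eq_true, if_false] <;> omega

theorem powTwoT_time (k : ℕ) : (powTwoT k).time = k + 1 := by
  induction k with
  | zero => rfl
  | succ k ih => simp [powTwoT, natMulT, ih]

theorem fillGridT_time {d : ℕ} (w : ℕ) (ps : List (Pt d)) (g : Grid d) :
    (fillGridT w ps g).time = (9 * d + 3) * ps.length + 1 := by
  induction ps generalizing g with
  | nil => simp [fillGridT]
  | cons p ps ih =>
    simp [fillGridT, ih, cellOfT, mulT, floorT, natPredT, natMinT, readT, writeT]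
    ring

theorem buildTreeT_time_le {d : ℕ} (hd : 1 ≤ d) (g : Grid d) (k : ℕ) (c : Fin d → ℕ) :
    (buildTreeT g k c).time + (8 * d + 6) ≤ (10 * d + 8) * (2 ^ d) ^ k := by
  induction k generalizing c with
  | zero => simp [buildTreeT, readT]; omega
  | succ k ih =>
    have hb : 2 ≤ 2 ^ d := by
      calc 2 = 2 ^ 1 := rfl
        _ ≤ 2 ^ d := Nat.pow_le_pow_right (by norm_num) hd
    have hc : ∀ b, (childCellT c b).time = 4 * d + 1 := fun b => by
      have hj : ∀ j : Fin d, (do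
          let e ← natMulT 2 (c j)
          let bit ← testBitT b j
          if bit then natAddT e 1 else charge 1 e : Timed ℕ).time = 3 := fun j => by
        cases h : (b : ℕ).testBit j <;> simp [natMulT, testBitT, natAddT, h]
      rw [childCellT, time_tabulateT]
      simp only [hj]
      simp
      ring
    simp only [buildTreeT, time_bind, time_tabulateT, time_charge, hc]
    have hsum : ∑ b : Fin (2 ^ d), (4 * d + 1 + (buildTreeT g k (childCellT c b).val).time + 1)
        + 2 ^ d * (4 * d + 4) ≤ 2 ^ d * ((10 * d + 8) * (2 ^ d) ^ k) := by
      have : 2 ^ d * (4 * d + 4) = ∑ b : Fin (2 ^ d), (4 * d + 4) := by simp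
      rw [this, ← Finset.sum_add_distrib]
      refine (Finset.sum_le_card_nsmul _ _ ((10 * d + 8) * (2 ^ d) ^ k) fun b _ => ?_).trans ?_
      · have := ih (childCellT c b).val
        omega
      · simp
    calc _ ≤ ∑ b : Fin (2 ^ d), (4 * d + 1 + (buildTreeT g k (childCellT c b).val).time + 1)
        + 2 ^ d * (4 * d + 4) := by
          have : 2 * (4 * d + 4) ≤ 2 ^ d * (4 * d + 4) := Nat.mul_le_mul_right _ hb
          omega
      _ ≤ _ := hsum
      _ = _ := by ring

/-- The number of leaf cells of the quadtree for `n` points. -/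
def leafCount (d n : ℕ) : ℕ := (2 ^ d) ^ Nat.clog (2 ^ d) n

theorem le_leafCount {d : ℕ} (hd : 1 ≤ d) (n : ℕ) : n ≤ leafCount d n :=
  Nat.le_pow_clog (Nat.one_lt_two_pow (by omega)) n

theorem leafCount_le {d : ℕ} (hd : 1 ≤ d) {n : ℕ} (hn : 1 ≤ n) : leafCount d n ≤ 2 ^ d * n := by
  have hb : 1 < 2 ^ d := Nat.one_lt_two_pow (by omega)
  unfold leafCount
  rcases Nat.lt_or_ge 1 n with h | h
  · have h1 := Nat.pow_pred_clog_lt_self hb h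
    have h2 := Nat.clog_pos hb h
    obtain ⟨k, hk⟩ := Nat.exists_eq_succ_of_ne_zero h2.ne'
    rw [hk] at h1 ⊢
    rw [Nat.pow_succ, mul_comm]
    exact Nat.mul_le_mul_left _ h1.le
  · obtain rfl : n = 1 := le_antisymm h hn
    simp [Nat.clog_one_right, Nat.one_le_two_pow]

theorem quadTreeT_time_le {d : ℕ} (hd : 1 ≤ d) (pts : List (Pt d)) (hn : 1 ≤ pts.length) :
    (quadTreeT pts).time ≤ (22 * d + 23) * leafCount d pts.length := by
  have h1 := le_leafCount hd pts.length
  have h2 : (heightT d pts.length).time ≤ (d + 1) + (4 * pts.length + 1) := by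
    simp only [heightT, time_bind, powTwoT_time]
    exact Nat.add_le_add_left (heightLoopT_time_le _ _ _ _ _ _) _
  simp only [quadTreeT, time_bind, lengthT_val, lengthT_time, heightT_val_clog d _ hd, newGridT,
    val_charge, time_charge, fillGridT_time, time_tabulateT, val_tabulateT]
  have h3 := buildTreeT_time_le hd
    (fillGridT (2 ^ Nat.clog (2 ^ d) pts.length) pts fun _ => []).val
    (Nat.clog (2 ^ d) pts.length) fun _ => 0
  have h4 : (2 ^ Nat.clog (2 ^ d) pts.length) ^ d = leafCount d pts.length := by
    rw [leafCount, ← pow_mul, ← pow_mul, mul_comm]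
  have h5 : (2 ^ d) ^ Nat.clog (2 ^ d) pts.length = leafCount d pts.length := rfl
  rw [h4]
  rw [h5] at h3
  have h6 : (9 * d + 3) * pts.length ≤ (9 * d + 3) * leafCount d pts.length :=
    Nat.mul_le_mul_left _ h1
  have h7 : d * 1 ≤ d * leafCount d pts.length := Nat.mul_le_mul_left _ (hn.trans h1)
  simp only [Finset.sum_const, Finset.card_univ, Fintype.card_fin, smul_eq_mul]
  ring_nf at h2 h3 h6 h7 ⊢
  omega

theorem traverseT_node_time_le {d c κ : ℕ} {leafHull mergeHull : List (Pt d) → Timed (Hull d)}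
    (hm : RunsInTime mergeHull c κ) (ch : Fin (2 ^ d) → QuadTree d) :
    (traverseT leafHull mergeHull (.node ch)).time ≤
      ∑ b, (traverseT leafHull mergeHull (ch b)).time + (4 * 2 ^ d + 4 + c) *
        (∑ b, (traverseT leafHull mergeHull (ch b)).val.vertices.length + 1) ^ (κ + 1) := by
  simp only [traverseT, time_bind, time_tabulateT, val_tabulateT]
  let times := fun b => (traverseT leafHull mergeHull (ch b)).time
  let hulls := fun b => (traverseT leafHull mergeHull (ch b)).val
  change 1 + ∑ b, (times b + 1)
      + ((mapT (fun b => charge 1 (hulls b).vertices) (List.finRange (2 ^ d))).time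
        + ((concatT (mapT (fun b => charge 1 (hulls b).vertices) (List.finRange (2 ^ d))).val).time
          + (mergeHull (concatT (mapT (fun b => charge 1 (hulls b).vertices)
              (List.finRange (2 ^ d))).val).val).time))
    ≤ ∑ b, times b + (4 * 2 ^ d + 4 + c) * (∑ b, (hulls b).vertices.length + 1) ^ (κ + 1)
  clear_value times hulls
  have t1 : (mapT (fun b => charge 1 (hulls b).vertices) (List.finRange (2 ^ d))).time
      ≤ (1 + 1) * 2 ^ d + 1 := mapT_time_le (fun _ _ => by simp) (by simp)
  have t2 := concatT_time
    (mapT (fun b => charge 1 (hulls b).vertices) (List.finRange (2 ^ d))).val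
  have t3 := hm (concatT (mapT (fun b => charge 1 (hulls b).vertices)
    (List.finRange (2 ^ d))).val).val
  rw [← concatT_val, concatT_mapT_val] at t2
  have l1 : ((List.finRange (2 ^ d)).map fun b => (hulls b).vertices).flatten.length
      = ∑ b, (hulls b).vertices.length := by
    rw [List.length_flatten, List.map_map, ← List.ofFn_eq_map, List.sum_ofFn]
    rfl
  have l2 : (mapT (fun b => charge 1 (hulls b).vertices) (List.finRange (2 ^ d))).val.length
      = 2 ^ d := by simp [mapT_val]
  rw [concatT_mapT_val] at t3
  rw [concatT_mapT_val]
  rw [l1, l2] at t2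
  rw [l1] at t3
  set s := ∑ b, (hulls b).vertices.length with hs
  have p1 : s + 1 ≤ (s + 1) ^ (κ + 1) := Nat.le_self_pow (by omega) _
  have p2 : c * (s + 1) ^ κ ≤ c * (s + 1) ^ (κ + 1) :=
    Nat.mul_le_mul_left _ (Nat.pow_le_pow_right (by omega) (by omega))
  have p3 : (4 * 2 ^ d + 3) * 1 ≤ (4 * 2 ^ d + 3) * (s + 1) ^ (κ + 1) :=
    Nat.mul_le_mul_left _ (by omega)
  simp only [Finset.sum_add_distrib, Finset.sum_const, Finset.card_univ, Fintype.card_fin,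
    smul_eq_mul, mul_one]
  have e : (4 * 2 ^ d + 4 + c) * (s + 1) ^ (κ + 1) = (4 * 2 ^ d + 3) * (s + 1) ^ (κ + 1)
    + (s + 1) ^ (κ + 1) + c * (s + 1) ^ (κ + 1) := by ring
  omega

/-- A bound on the running time of the traversal of the subtree of height `k` below a cell, given
the numbers `N` of points in the leaf cells and `Y` of vertices in all cells. -/
def costBound {d : ℕ} (K p : ℕ) (N : (Fin d → ℕ) → ℕ) (Y : ℕ → (Fin d → ℕ) → ℕ) :
    ℕ → (Fin d → ℕ) → ℕ
  | 0, c => K * (N c + 1) ^ p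
  | k + 1, c => ∑ b, costBound K p N Y k (childCellT c b).val
      + K * (∑ b, Y k (childCellT c b).val + 1) ^ p

theorem traverseT_time_le {d c κ : ℕ} {leafHull mergeHull : List (Pt d) → Timed (Hull d)}
    (hl : RunsInTime leafHull c κ) (hm : RunsInTime mergeHull c κ) (g : Grid d)
    (Y : ℕ → (Fin d → ℕ) → ℕ)
    (hY : ∀ k c, (traverseT leafHull mergeHull (buildTreeT g k c).val).val.vertices.length ≤ Y k c)
    (k : ℕ) (x : Fin d → ℕ) :
    (traverseT leafHull mergeHull (buildTreeT g k x).val).time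
      ≤ costBound (4 * 2 ^ d + 4 + c) (κ + 1) (fun c => (g c).length) Y k x := by
  induction k generalizing x with
  | zero =>
    simp only [buildTreeT, val_bind, readT, val_charge, traverseT, time_bind, time_charge,
      costBound]
    have h1 := hl (g x)
    have h2 : c * ((g x).length + 1) ^ κ ≤ c * ((g x).length + 1) ^ (κ + 1) :=
      Nat.mul_le_mul_left _ (Nat.pow_le_pow_right (by omega) (by omega))
    have h3 : 1 ≤ (4 * 2 ^ d + 4) * ((g x).length + 1) ^ (κ + 1) := Nat.mul_pos (by omega)
      (by positivity)
    rw [add_mul]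
    omega
  | succ k ih =>
    simp only [buildTreeT, val_bind, val_tabulateT, val_charge]
    refine (traverseT_node_time_le hm _).trans ?_
    simp only [costBound]
    refine Nat.add_le_add (Finset.sum_le_sum fun b _ => ih _) (Nat.mul_le_mul_left _ ?_)
    exact Nat.pow_le_pow_left (Nat.add_le_add_right (Finset.sum_le_sum fun b _ => hY _ _) 1) _

/-! ### Vertices and undominated points -/

/-- The part of a cell that lies strictly beyond `x` in the direction of the orthant with sign
vector `σ`. -/
def beyond {d : ℕ} (w k : ℕ) (c : Fin d → ℕ) (σ : Fin d → Bool) (x : Pt d) : Set (Pt d) :=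
  {y | InCell w k c y ∧ ∀ j, if σ j then x j < y j else y j < x j}

open Classical in
/-- Every vertex of the hull of the sample points in a cell is undominated among them with respect
to some orthant: the one that contains a functional maximal only at the vertex. -/
theorem vertices_length_le {d n : ℕ} (hd : 1 ≤ d)
    {leafHull mergeHull : List (Pt d) → Timed (Hull d)}
    (hl : ComputesHull leafHull) (hm : ComputesHull mergeHull) (w k : ℕ) (c : Fin d → ℕ)
    (P : Fin n → Pt d) :
    (traverseT leafHull mergeHull
        (buildTreeT (leafGrid w (List.ofFn P)) k c).val).val.vertices.length
      ≤ ∑ σ : Fin d → Bool, (Finset.univ.filter fun i =>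
        InCell w k c (P i) ∧ ∀ j, P j ∉ beyond w k c σ (P i)).card := by
  set l := (List.ofFn P).filter fun x => decide (InCell w k c x) with hldef
  have hlm : ∀ x, x ∈ l ↔ (∃ i, P i = x) ∧ InCell w k c x := fun x => by
    simp [hldef, List.mem_ofFn]
  have hH := isHull_traverseT hl hm (buildTreeT (leafGrid w (List.ofFn P)) k c).val l (by
    rw [points_buildTreeT (mem_leafGrid w (List.ofFn P))]
    ext x
    simp [hlm, List.mem_ofFn])
  set V := (traverseT leafHull mergeHull
    (buildTreeT (leafGrid w (List.ofFn P)) k c).val).val.vertices with hV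
  have hsub : V.toFinset ⊆ (Finset.univ.biUnion fun σ : Fin d → Bool => Finset.univ.filter fun i =>
      InCell w k c (P i) ∧ ∀ j, P j ∉ beyond w k c σ (P i)).image P := by
    intro x hx
    have hx' : x ∈ {x | x ∈ V} := by simpa using hx
    rw [hH.vertices_eq, mem_extremePoints_hullSet_iff] at hx'
    obtain ⟨hxl, f, hf⟩ := hx'
    obtain ⟨u, rfl⟩ := exists_functional_eq f
    obtain ⟨⟨i, rfl⟩, hi⟩ := (hlm x).1 hxl
    refine Finset.mem_image.2 ⟨i, Finset.mem_biUnion.2 ⟨fun j => decide (0 ≤ u j),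
      Finset.mem_univ _, Finset.mem_filter.2 ⟨Finset.mem_univ _, hi, fun j hj => ?_⟩⟩, rfl⟩
    obtain ⟨hj1, hj2⟩ := hj
    have hne : P j ≠ P i := by
      intro h
      have := hj2 ⟨0, hd⟩
      rw [h] at this
      simp at this
    have hlt := hf (P j) ((hlm _).2 ⟨⟨j, rfl⟩, hj1⟩) hne
    rw [functional_apply, functional_apply] at hlt
    refine absurd hlt (not_lt.2 (Finset.sum_le_sum fun a _ => ?_))
    have := hj2 a
    by_cases hu : 0 ≤ u a
    · simp only [hu, decide_true, if_true] at this
      exact mul_le_mul_of_nonneg_left this.le hu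
    · simp only [hu, decide_false, Bool.false_eq_true, if_false] at this
      exact mul_le_mul_of_nonpos_left this.le (not_le.1 hu).le
  rw [← List.toFinset_card_of_nodup hH.vertices_nodup]
  exact (Finset.card_le_card hsub).trans (Finset.card_image_le.trans Finset.card_biUnion_le)

open Classical in
theorem leafGrid_length {d n : ℕ} (w : ℕ) (P : Fin n → Pt d) (c : Fin d → ℕ) :
    (leafGrid w (List.ofFn P) c).length
      = (Finset.univ.filter fun i => InCell w 0 c (P i)).card := by
  rw [leafGrid_apply, List.length_reverse, List.ofFn_eq_map, List.filter_map, List.length_map]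
  have hnd : ((List.finRange n).filter
      ((fun p => decide ((cellOfT w p).val = c)) ∘ P)).Nodup := (List.nodup_finRange n).filter _
  rw [← List.toFinset_card_of_nodup hnd]
  congr 1
  ext i
  simp [cellOfT_eq_iff]

/-! ### Moments of the number of undominated points -/

theorem lintegral_pi_fin_prod {α : Type} [MeasurableSpace α] {n : ℕ} (μ : Fin n → Measure α)
    [∀ i, SigmaFinite (μ i)] {f : Fin n → α → ℝ≥0∞} (hf : ∀ i, Measurable (f i)) :
    ∫⁻ x, ∏ i, f i (x i) ∂Measure.pi μ = ∏ i, ∫⁻ x, f i x ∂μ i := by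
  induction n with
  | zero => simp
  | succ n ih =>
    have hm : Measurable fun x : Fin n → α => ∏ i : Fin n, f i.succ (x i) :=
      Finset.measurable_prod _ fun i _ => (hf _).comp (measurable_pi_apply i)
    rw [Fin.prod_univ_succ, ← ih (fun i => μ i.succ) (fun i => hf i.succ),
      ← lintegral_prod_mul (hf 0).aemeasurable hm.aemeasurable,
      ← (measurePreserving_piFinSuccAbove μ 0).symm.lintegral_comp_emb
        (MeasurableEquiv.measurableEmbedding _)]
    simp_rw [MeasurableEquiv.piFinSuccAbove_symm_apply, Fin.insertNthEquiv,
      Fin.prod_univ_succ, Fin.insertNth_zero]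
    simp

theorem lintegral_pi_prod {ι α : Type} [Fintype ι] [MeasurableSpace α] (μ : ι → Measure α)
    [∀ i, SigmaFinite (μ i)] {f : ι → α → ℝ≥0∞} (hf : ∀ i, Measurable (f i)) :
    ∫⁻ x, ∏ i, f i (x i) ∂Measure.pi μ = ∏ i, ∫⁻ x, f i x ∂μ i := by
  let e := (Fintype.equivFin ι).symm
  rw [← (measurePreserving_piCongrLeft μ e).lintegral_comp_emb
    (MeasurableEquiv.measurableEmbedding _), ← e.prod_comp,
    ← lintegral_pi_fin_prod (fun i => μ (e i)) fun i => hf (e i)]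
  refine lintegral_congr fun x => ?_
  rw [← e.prod_comp]
  refine Finset.prod_congr rfl fun i _ => ?_
  rw [MeasurableEquiv.coe_piCongrLeft, Equiv.piCongrLeft_apply_apply]

theorem pow_le_descFactorial (x p : ℕ) :
    x ^ p ≤ 2 ^ p * x.descFactorial p + (2 * p) ^ p := by
  rcases Nat.lt_or_ge x (2 * p) with h | h
  · exact (Nat.pow_le_pow_left h.le p).trans (Nat.le_add_left _ _)
  · refine le_trans ?_ (Nat.le_add_right _ _)
    calc x ^ p ≤ (2 * (x + 1 - p)) ^ p := Nat.pow_le_pow_left (by omega) p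
      _ = 2 ^ p * (x + 1 - p) ^ p := mul_pow _ _ _
      _ ≤ _ := Nat.mul_le_mul_left _ (Nat.pow_sub_le_descFactorial x p)

open Classical in
/-- The `p`-th moment of the number of events that occur, if any `p` of them occur together with
probability at most `r ^ p`. The factorial moment is a sum over the `p`-sets of events. -/
theorem lintegral_card_pow_le {Ω : Type} [MeasurableSpace Ω] (μ : Measure Ω)
    [IsProbabilityMeasure μ] {n p : ℕ} {A : Fin n → Set Ω} (hA : ∀ i, MeasurableSet (A i))
    {r : ℝ≥0∞} (hr : ∀ T : Finset (Fin n), T.card = p → μ (⋂ i ∈ T, A i) ≤ r ^ p) :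
    ∫⁻ ω, ((Finset.univ.filter fun i => ω ∈ A i).card : ℝ≥0∞) ^ p ∂μ
      ≤ 2 ^ p * (n * r) ^ p + (2 * p) ^ p := by
  have hmeas : ∀ T : Finset (Fin n), MeasurableSet (⋂ i ∈ T, A i) := fun T =>
    T.measurableSet_biInter fun i _ => hA i
  have hpt : ∀ ω, ((Finset.univ.filter fun i => ω ∈ A i).card : ℝ≥0∞) ^ p
      ≤ 2 ^ p * (p.factorial * ∑ T ∈ Finset.powersetCard p (Finset.univ : Finset (Fin n)),
        (⋂ i ∈ T, A i).indicator 1 ω) + (2 * p) ^ p := by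
    intro ω
    set F := Finset.univ.filter fun i => ω ∈ A i with hF
    have h1 : (∑ T ∈ Finset.powersetCard p (Finset.univ : Finset (Fin n)),
        (⋂ i ∈ T, A i).indicator (1 : Ω → ℝ≥0∞) ω) = (F.card.choose p : ℝ≥0∞) := by
      rw [← Finset.card_powersetCard]
      simp only [Set.indicator_apply, Pi.one_apply, Finset.sum_boole]
      congr 2
      ext T
      simp only [Finset.mem_filter, Finset.mem_powersetCard, true_and,
        Set.mem_iInter, Finset.subset_iff, hF, Finset.mem_univ]
      tauto
    rw [h1]
    have h2 := pow_le_descFactorial F.card p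
    rw [Nat.descFactorial_eq_factorial_mul_choose] at h2
    exact_mod_cast h2
  calc _ ≤ ∫⁻ ω, (2 ^ p * (p.factorial *
        ∑ T ∈ Finset.powersetCard p (Finset.univ : Finset (Fin n)),
          (⋂ i ∈ T, A i).indicator 1 ω) + (2 * p) ^ p) ∂μ := lintegral_mono hpt
    _ = 2 ^ p * (p.factorial * ∑ T ∈ Finset.powersetCard p (Finset.univ : Finset (Fin n)),
          μ (⋂ i ∈ T, A i)) + (2 * p) ^ p := by
      have hind : ∀ T ∈ Finset.powersetCard p (Finset.univ : Finset (Fin n)),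
          Measurable ((⋂ i ∈ T, A i).indicator (1 : Ω → ℝ≥0∞)) := fun T _ =>
        measurable_one.indicator (hmeas T)
      rw [lintegral_add_right _ measurable_const, lintegral_const, measure_univ, mul_one,
        lintegral_const_mul _ ((Finset.measurable_fun_sum _ hind).const_mul _),
        lintegral_const_mul _ (Finset.measurable_fun_sum _ hind), lintegral_finsetSum _ hind]
      simp only [lintegral_indicator_one (hmeas _)]
    _ ≤ 2 ^ p * (p.factorial * ∑ T ∈ Finset.powersetCard p (Finset.univ : Finset (Fin n)),
          r ^ p) + (2 * p) ^ p := by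
      gcongr with T hT
      exact hr T (Finset.mem_powersetCard.1 hT).2
    _ = 2 ^ p * ((n.descFactorial p : ℕ) * r ^ p) + (2 * p) ^ p := by
      rw [Finset.sum_const, Finset.card_powersetCard, Finset.card_univ, Fintype.card_fin,
        Nat.descFactorial_eq_factorial_mul_choose, nsmul_eq_mul, Nat.cast_mul, mul_assoc]
    _ ≤ _ := by
      rw [mul_pow (n : ℝ≥0∞) r p]
      gcongr
      exact_mod_cast n.descFactorial_le_pow p

/-- Bound for the probability that `n - p` independent points miss a set of probability `v`, in a
form that splits into `p` factors. -/
theorem one_sub_pow_le {v : ℝ≥0∞} (hv : v ≤ 1) (n : ℕ) {p : ℕ} (hp : 1 ≤ p) :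
    (1 - v) ^ (n - p) ≤ (min 1 (2 * p / (n * v))) ^ p := by
  have h1 : (1 - v) ^ (n - p) ≤ 1 := pow_le_one' tsub_le_self _
  rcases min_choice (1 : ℝ≥0∞) (2 * p / (n * v)) with h | h
  · rw [h, one_pow]
    exact h1
  · rw [h]
    set M := (n - p) / p with hM
    have h2 : (1 - v) ^ (n - p) ≤ ((1 - v) ^ M) ^ p := by
      rw [← pow_mul]
      exact pow_le_pow_right_of_le_one' tsub_le_self (Nat.div_mul_le_self _ _)
    refine h2.trans (pow_le_pow_left' ?_ p)
    have hvt : v ≠ ∞ := ne_top_of_le_ne_top ENNReal.one_ne_top hv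
    have hp0 : (2 * p : ℝ≥0∞) ≠ 0 := by
      simp only [ne_eq, mul_eq_zero, OfNat.ofNat_ne_zero, Nat.cast_eq_zero, false_or]
      omega
    rw [ENNReal.le_div_iff_mul_le (Or.inr hp0) (Or.inl (ENNReal.mul_ne_top (by simp) hvt))]
    obtain ⟨r, rfl⟩ : ∃ r : ℝ≥0, (r : ℝ≥0∞) = v := ⟨v.toNNReal, ENNReal.coe_toNNReal hvt⟩
    have hr : r ≤ 1 := by exact_mod_cast hv
    have hn : n ≤ p * M + 2 * p := by
      have := Nat.lt_div_mul_add (a := n - p) (b := p) (by omega)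
      rw [← hM, mul_comm] at this
      omega
    suffices (1 - r) ^ M * (n * r) ≤ 2 * p by exact_mod_cast this
    rw [← NNReal.coe_le_coe]
    push_cast [NNReal.coe_sub hr]
    have hr0 : (0 : ℝ) ≤ r := r.2
    have hr1 : (r : ℝ) ≤ 1 := hr
    have k1 : (1 - (r : ℝ)) ^ M * (1 + M * r) ≤ 1 := by
      calc (1 - (r : ℝ)) ^ M * (1 + M * r) ≤ (1 - (r : ℝ)) ^ M * (1 + r) ^ M := by
            refine mul_le_mul_of_nonneg_left ?_ (pow_nonneg (by linarith) _)
            exact one_add_mul_le_pow (by linarith) M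
        _ = ((1 - r) * (1 + r)) ^ M := (mul_pow _ _ _).symm
        _ ≤ 1 := pow_le_one₀ (by nlinarith) (by nlinarith)
    have k2 : (n : ℝ) * r ≤ 2 * p * (1 + M * r) := by
      have : (n : ℝ) ≤ p * M + 2 * p := by exact_mod_cast hn
      have hp' : (0 : ℝ) ≤ p := Nat.cast_nonneg _
      have hM' : (0 : ℝ) ≤ M := Nat.cast_nonneg _
      nlinarith [mul_le_mul_of_nonneg_right this hr0, mul_nonneg (mul_nonneg hp' hM') hr0,
        mul_le_mul_of_nonneg_left hr1 hp']
    calc (1 - (r : ℝ)) ^ M * (n * r) ≤ (1 - (r : ℝ)) ^ M * (2 * p * (1 + M * r)) :=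
          mul_le_mul_of_nonneg_left k2 (pow_nonneg (by linarith) _)
      _ = 2 * p * ((1 - (r : ℝ)) ^ M * (1 + M * r)) := by ring
      _ ≤ 2 * p * 1 := by gcongr
      _ = 2 * p := mul_one _

/-- The weight of a point `x` in the bound for the expected number of undominated points, where
`B x` is the set of points that dominate `x`. -/
def weight {α : Type} [MeasurableSpace α] (ν : Measure α) (n p : ℕ) (B : α → Set α) (x : α) :
    ℝ≥0∞ := min 1 (2 * p / (n * ν (B x)))

/-- The event that the `i`-th sample point lies in `R` and is undominated. -/
def undominated {α : Type} {n : ℕ} (R : Set α) (B : α → Set α) (i : Fin n) : Set (Fin n → α) :=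
  {P | P i ∈ R ∧ ∀ j, P j ∉ B (P i)}

theorem measurableSet_undominated {α : Type} [MeasurableSpace α] {n : ℕ} {R : Set α}
    {B : α → Set α} (hR : MeasurableSet R) (hB : MeasurableSet {q : α × α | q.2 ∈ B q.1})
    (i : Fin n) : MeasurableSet (undominated R B i) := by
  refine MeasurableSet.inter (measurable_pi_apply i hR) ?_
  have : {P : Fin n → α | ∀ j, P j ∉ B (P i)}
      = ⋂ j, (fun P : Fin n → α => (P i, P j)) ⁻¹' {q : α × α | q.2 ∈ B q.1}ᶜ := by
    ext P
    simp
  change MeasurableSet {P : Fin n → α | ∀ j, P j ∉ B (P i)}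
  rw [this]
  exact MeasurableSet.iInter fun j =>
    ((measurable_pi_apply i).prodMk (measurable_pi_apply j)) hB.compl

theorem measurable_weight {α : Type} [MeasurableSpace α] {ν : Measure α} [SFinite ν] {n p : ℕ}
    {B : α → Set α} (hB : MeasurableSet {q : α × α | q.2 ∈ B q.1}) :
    Measurable (weight ν n p B) := by
  have : Measurable fun x => ν (B x) := measurable_measure_prodMk_left hB
  exact measurable_const.min (measurable_const.div (this.const_mul _))

/-- Given the positions of `p` sample points, all of them are undominated only if the other points
avoid each of the dominating sets. This probability is at most the `p`-th power of each of the `p`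
weights, hence at most their product, and the product integrates to a power. -/
theorem measure_iInter_undominated_le {α : Type} [MeasurableSpace α] (ν : Measure α)
    [IsProbabilityMeasure ν] {n p : ℕ} (hp : 1 ≤ p) {R : Set α} {B : α → Set α}
    (hR : MeasurableSet R) (hB : MeasurableSet {q : α × α | q.2 ∈ B q.1})
    (T : Finset (Fin n)) (hT : T.card = p) :
    Measure.pi (fun _ : Fin n => ν) (⋂ i ∈ T, undominated R B i)
      ≤ (∫⁻ x in R, weight ν n p B x ∂ν) ^ p := by
  classical
  let e := MeasurableEquiv.piEquivPiSubtypeProd (fun _ : Fin n => α) (· ∈ T)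
  let F : Set (({i // i ∈ T} → α) × ({i // i ∉ T} → α)) :=
    {q | (∀ i, q.1 i ∈ R) ∧ ∀ i j, q.2 j ∉ B (q.1 i)}
  have hF : MeasurableSet F := by
    have : F = (⋂ i, (fun q => q.1 i) ⁻¹' R) ∩
        ⋂ i, ⋂ j, (fun q => (q.1 i, q.2 j)) ⁻¹' {q : α × α | q.2 ∈ B q.1}ᶜ := by
      ext q
      simp [F]
    rw [this]
    refine MeasurableSet.inter (MeasurableSet.iInter fun i => ?_)
      (MeasurableSet.iInter fun i => MeasurableSet.iInter fun j => ?_)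
    · exact ((measurable_pi_apply i).comp measurable_fst) hR
    · exact (((measurable_pi_apply i).comp measurable_fst).prodMk
        ((measurable_pi_apply j).comp measurable_snd)) hB.compl
  have hsub : (⋂ i ∈ T, undominated R B i) ⊆ e ⁻¹' F := by
    intro P hP
    simp only [Set.mem_iInter] at hP
    exact ⟨fun i => (hP i.1 i.2).1, fun i j => (hP i.1 i.2).2 j.1⟩
  have hmp : MeasurePreserving e (Measure.pi fun _ : Fin n => ν)
      ((Measure.pi fun _ : {i // i ∈ T} => ν).prod (Measure.pi fun _ : {i // i ∉ T} => ν)) := by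
    convert measurePreserving_piEquivPiSubtypeProd (fun _ : Fin n => ν) (· ∈ T)
  calc _ ≤ Measure.pi (fun _ : Fin n => ν) (e ⁻¹' F) := measure_mono hsub
    _ = ((Measure.pi fun _ : {i // i ∈ T} => ν).prod (Measure.pi fun _ : {i // i ∉ T} => ν)) F :=
      hmp.measure_preimage hF.nullMeasurableSet
    _ = ∫⁻ x, (Measure.pi fun _ : {i // i ∉ T} => ν) (Prod.mk x ⁻¹' F)
          ∂(Measure.pi fun _ : {i // i ∈ T} => ν) := Measure.prod_apply hF
    _ ≤ ∫⁻ x, ∏ i, R.indicator (weight ν n p B) (x i)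
          ∂(Measure.pi fun _ : {i // i ∈ T} => ν) := by
      refine lintegral_mono fun x => ?_
      by_cases hx : ∀ i, x i ∈ R
      · have hne : (Finset.univ : Finset {i // i ∈ T}).Nonempty := by
          rw [Finset.univ_nonempty_iff]
          obtain ⟨i, hi⟩ := Finset.card_pos.1 (hT ▸ hp : 0 < T.card)
          exact ⟨⟨i, hi⟩⟩
        obtain ⟨a, -, ha⟩ := Finset.univ.exists_min_image (fun i => weight ν n p B (x i)) hne
        have hBa : MeasurableSet (B (x a)) := measurable_prodMk_left hB
        calc (Measure.pi fun _ : {i // i ∉ T} => ν) (Prod.mk x ⁻¹' F)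
            ≤ (Measure.pi fun _ : {i // i ∉ T} => ν) (Set.univ.pi fun _ => (B (x a))ᶜ) :=
              measure_mono fun y hy j _ => hy.2 a j
          _ = (1 - ν (B (x a))) ^ (n - p) := by
              rw [Measure.pi_pi, Finset.prod_const, prob_compl_eq_one_sub hBa, Finset.card_univ]
              congr 1
              rw [Fintype.card_subtype_compl, Fintype.card_fin, Fintype.card_coe, hT]
          _ ≤ (weight ν n p B (x a)) ^ p := one_sub_pow_le prob_le_one n hp
          _ = ∏ _i : {i // i ∈ T}, weight ν n p B (x a) := by
              rw [Finset.prod_const, Finset.card_univ, Fintype.card_coe, hT]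
          _ ≤ ∏ i, R.indicator (weight ν n p B) (x i) := by
              refine Finset.prod_le_prod' fun i hi => ?_
              rw [Set.indicator_of_mem (hx i)]
              exact ha i hi
      · have : Prod.mk x ⁻¹' F = ∅ := by
          ext y
          simp only [Set.mem_preimage, Set.mem_empty_iff_false, iff_false]
          exact fun h => hx h.1
        rw [this, measure_empty]
        exact zero_le
    _ = _ := by
      rw [lintegral_pi_prod _ fun _ => (measurable_weight hB).indicator hR, Finset.prod_const,
        Finset.card_univ, Fintype.card_coe, hT, lintegral_indicator hR]

open Classical in
theorem lintegral_card_undominated_pow_le {α : Type} [MeasurableSpace α] (ν : Measure α)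
    [IsProbabilityMeasure ν] {n p : ℕ} (hp : 1 ≤ p) {R : Set α} {B : α → Set α}
    (hR : MeasurableSet R) (hB : MeasurableSet {q : α × α | q.2 ∈ B q.1}) :
    ∫⁻ P, ((Finset.univ.filter fun i => P ∈ undominated R B i).card : ℝ≥0∞) ^ p
        ∂Measure.pi (fun _ : Fin n => ν)
      ≤ 2 ^ p * (n * ∫⁻ x in R, weight ν n p B x ∂ν) ^ p + (2 * p) ^ p :=
  lintegral_card_pow_le _ (fun i => measurableSet_undominated hR hB i) fun T hT =>
    measure_iInter_undominated_le ν hp hR hB T hT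

/-! ### The integral of the weight over a cell -/

theorem lintegral_rpow_Icc {a ℓ : ℝ} (ha : 0 < a) (hℓ : 0 ≤ ℓ) :
    ∫⁻ t in Set.Icc 0 ℓ, ENNReal.ofReal t ^ (a - 1) = ENNReal.ofReal (ℓ ^ a / a) := by
  have h1 : ∫⁻ t in Set.Icc 0 ℓ, ENNReal.ofReal t ^ (a - 1)
      = ∫⁻ t in Set.Ioc 0 ℓ, ENNReal.ofReal (t ^ (a - 1)) := by
    rw [setLIntegral_congr (Ioc_ae_eq_Icc (μ := volume)).symm]
    exact setLIntegral_congr_fun measurableSet_Ioc fun t ht => ENNReal.ofReal_rpow_of_pos ht.1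
  have hint : IntervalIntegrable (fun t : ℝ => t ^ (a - 1)) volume 0 ℓ :=
    intervalIntegral.intervalIntegrable_rpow' (by linarith)
  rw [h1, ← ofReal_integral_eq_lintegral_ofReal
    ((intervalIntegrable_iff_integrableOn_Ioc_of_le hℓ).1 hint)
    ((ae_restrict_mem measurableSet_Ioc).mono fun t ht => Real.rpow_nonneg ht.1.le _),
    ← intervalIntegral.integral_of_le hℓ, integral_rpow (Or.inl (by linarith))]
  simp [Real.zero_rpow ha.ne']

theorem lintegral_rpow_sub_left {a lo hi : ℝ} (ha : 0 < a) (h : lo ≤ hi) :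
    ∫⁻ t in Set.Icc lo hi, ENNReal.ofReal (t - lo) ^ (a - 1)
      = ENNReal.ofReal ((hi - lo) ^ a / a) := by
  rw [← lintegral_rpow_Icc ha (sub_nonneg.2 h), ← lintegral_indicator measurableSet_Icc,
    ← lintegral_indicator measurableSet_Icc,
    ← lintegral_sub_right_eq_self (μ := volume)
      ((Set.Icc 0 (hi - lo)).indicator fun t => ENNReal.ofReal t ^ (a - 1)) lo]
  refine lintegral_congr fun t => ?_
  by_cases ht : t ∈ Set.Icc lo hi
  · rw [Set.indicator_of_mem ht, Set.indicator_of_mem (by constructor <;> linarith [ht.1, ht.2])]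
  · rw [Set.indicator_of_notMem ht,
      Set.indicator_of_notMem fun h' => ht (by constructor <;> linarith [h'.1, h'.2])]

theorem lintegral_rpow_sub_right {a lo hi : ℝ} (ha : 0 < a) (h : lo ≤ hi) :
    ∫⁻ t in Set.Icc lo hi, ENNReal.ofReal (hi - t) ^ (a - 1)
      = ENNReal.ofReal ((hi - lo) ^ a / a) := by
  rw [← lintegral_rpow_Icc ha (sub_nonneg.2 h), ← lintegral_indicator measurableSet_Icc,
    ← lintegral_indicator measurableSet_Icc,
    ← lintegral_sub_left_eq_self (μ := volume)
      ((Set.Icc 0 (hi - lo)).indicator fun t => ENNReal.ofReal t ^ (a - 1)) hi]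
  refine lintegral_congr fun t => ?_
  by_cases ht : t ∈ Set.Icc lo hi
  · rw [Set.indicator_of_mem ht, Set.indicator_of_mem (by constructor <;> linarith [ht.1, ht.2])]
  · rw [Set.indicator_of_notMem ht,
      Set.indicator_of_notMem fun h' => ht (by constructor <;> linarith [h'.1, h'.2])]

/-- The uniform distribution on the unit cube. -/
def cubeMeasure (d : ℕ) : Measure (Pt d) := volume.restrict (Set.Icc 0 1)

instance (d : ℕ) : IsProbabilityMeasure (cubeMeasure d) :=
  ⟨by simp [cubeMeasure, Real.volume_Icc_pi]⟩

theorem measurable_cellIndex {d : ℕ} (w k : ℕ) (j : Fin d) :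
    Measurable fun p : Pt d => min ⌊p j * w⌋₊ (w - 1) / 2 ^ k := by
  have h : Measurable fun p : Pt d => ⌊p j * w⌋₊ :=
    Nat.measurable_floor.comp ((measurable_pi_apply j).mul_const _)
  exact (measurable_from_top (f := fun m : ℕ => min m (w - 1) / 2 ^ k)).comp h

theorem measurableSet_inCell {d : ℕ} (w k : ℕ) (c : Fin d → ℕ) :
    MeasurableSet {p : Pt d | InCell w k c p} := by
  have : {p : Pt d | InCell w k c p}
      = ⋂ j, (fun p : Pt d => min ⌊p j * w⌋₊ (w - 1) / 2 ^ k) ⁻¹' {c j} := by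
    ext p
    simp [InCell]
  rw [this]
  exact MeasurableSet.iInter fun j => measurable_cellIndex w k j (MeasurableSet.singleton _)

theorem measurableSet_beyond {d : ℕ} (w k : ℕ) (c : Fin d → ℕ) (σ : Fin d → Bool) :
    MeasurableSet {q : Pt d × Pt d | q.2 ∈ beyond w k c σ q.1} := by
  have : {q : Pt d × Pt d | q.2 ∈ beyond w k c σ q.1} = Prod.snd ⁻¹' {p | InCell w k c p} ∩
      ⋂ j, {q : Pt d × Pt d | if σ j then q.1 j < q.2 j else q.2 j < q.1 j} := by
    ext q
    simp [beyond]
  rw [this]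
  refine (measurable_snd (measurableSet_inCell w k c)).inter (MeasurableSet.iInter fun j => ?_)
  have m1 : Measurable fun q : Pt d × Pt d => q.1 j := (measurable_pi_apply j).comp measurable_fst
  have m2 : Measurable fun q : Pt d × Pt d => q.2 j := (measurable_pi_apply j).comp measurable_snd
  by_cases h : σ j
  · simpa [h] using measurableSet_lt m1 m2
  · simpa [h] using measurableSet_lt m2 m1

/-- The lower corner of a cell. -/
def cellLo {d : ℕ} (w k : ℕ) (c : Fin d → ℕ) (j : Fin d) : ℝ := c j * (2 ^ k / w)

/-- The upper corner of a cell. -/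
def cellHi {d : ℕ} (w k : ℕ) (c : Fin d → ℕ) (j : Fin d) : ℝ := (c j + 1) * (2 ^ k / w)

theorem succ_mul_le_of_inCell {d w k : ℕ} {c : Fin d → ℕ} (hw : 1 ≤ w) (hk : 2 ^ k ∣ w) {x : Pt d}
    (hx : InCell w k c x) (j : Fin d) : (c j + 1) * 2 ^ k ≤ w := by
  obtain ⟨m, rfl⟩ := hk
  have h1 : c j * 2 ^ k ≤ 2 ^ k * m - 1 := by
    rw [← hx j]
    exact (Nat.div_mul_le_self _ _).trans (min_le_right _ _)
  have h2 : c j < m := by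
    by_contra! h
    have := Nat.mul_le_mul_left (2 ^ k) h
    rw [mul_comm (2 ^ k) (c j)] at this
    omega
  rw [mul_comm]
  exact Nat.mul_le_mul_left _ h2

theorem mem_Icc_of_inCell {d w k : ℕ} {c : Fin d → ℕ} (hw : 1 ≤ w) {x : Pt d}
    (hx : InCell w k c x) (hx1 : x ∈ Set.Icc (0 : Pt d) 1) :
    x ∈ Set.univ.pi fun j => Set.Icc (cellLo w k c j) (cellHi w k c j) := by
  intro j _
  have hw' : (0 : ℝ) < w := by exact_mod_cast hw
  have h0 : 0 ≤ x j * w := mul_nonneg (hx1.1 j) hw'.le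
  have hm1 : c j * 2 ^ k ≤ min ⌊x j * w⌋₊ (w - 1) := by
    rw [← hx j]
    exact Nat.div_mul_le_self _ _
  have hm2 : min ⌊x j * w⌋₊ (w - 1) < (c j + 1) * 2 ^ k := by
    rw [← hx j, Nat.add_mul, one_mul]
    exact Nat.lt_div_mul_add (by positivity)
  constructor
  · rw [cellLo, ← mul_div_assoc, div_le_iff₀ hw']
    calc (c j * 2 ^ k : ℝ) ≤ (⌊x j * w⌋₊ : ℝ) := by
          exact_mod_cast hm1.trans (min_le_left _ _)
      _ ≤ x j * w := Nat.floor_le h0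
  · rw [cellHi, ← mul_div_assoc, le_div_iff₀ hw']
    rcases le_or_gt ⌊x j * w⌋₊ (w - 1) with h | h
    · rw [min_eq_left h] at hm2
      calc x j * w ≤ (⌊x j * w⌋₊ : ℝ) + 1 := (Nat.lt_floor_add_one _).le
        _ ≤ (c j + 1) * 2 ^ k := by exact_mod_cast hm2
    · rw [min_eq_right h.le] at hm2
      calc x j * w ≤ 1 * w := mul_le_mul_of_nonneg_right (hx1.2 j) hw'.le
        _ = (w : ℝ) := one_mul _
        _ ≤ (c j + 1) * 2 ^ k := by
          have : w ≤ (c j + 1) * 2 ^ k := by omega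
          exact_mod_cast this

/-- The extent along an axis of the box spanned by `x` and a corner of its cell. -/
def boxSide {d : ℕ} (w k : ℕ) (c : Fin d → ℕ) (σ : Fin d → Bool) (j : Fin d) (t : ℝ) : ℝ :=
  if σ j then cellHi w k c j - t else t - cellLo w k c j

/-- The points of a cell beyond one of its points include the open box spanned by this point and a
corner of the cell. -/
theorem prod_boxSide_le {d w k : ℕ} {c : Fin d → ℕ} (hw : 1 ≤ w) (hk : 2 ^ k ∣ w)
    (σ : Fin d → Bool) {x : Pt d} (hx : InCell w k c x) (hx1 : x ∈ Set.Icc (0 : Pt d) 1) :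
    ∏ j, ENNReal.ofReal (boxSide w k c σ j (x j)) ≤ cubeMeasure d (beyond w k c σ x) := by
  have hw' : (0 : ℝ) < w := by exact_mod_cast hw
  have hxc := mem_Icc_of_inCell hw hx hx1
  let s : Fin d → Set ℝ := fun j =>
    if σ j then Set.Ioo (x j) (cellHi w k c j) else Set.Ioo (cellLo w k c j) (x j)
  have hs : ∀ j, s j ⊆ Set.Ioo (cellLo w k c j) (cellHi w k c j) := fun j => by
    have := hxc j (Set.mem_univ j)
    by_cases h : σ j
    · simpa [s, h] using Set.Ioo_subset_Ioo_left this.1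
    · simpa [s, h] using Set.Ioo_subset_Ioo_right this.2
  have hsub : Set.univ.pi s ⊆ beyond w k c σ x ∩ Set.Icc 0 1 := by
    intro y hy
    have hyc : ∀ j, cellLo w k c j < y j ∧ y j < cellHi w k c j := fun j =>
      hs j (hy j (Set.mem_univ j))
    have hup := fun j => succ_mul_le_of_inCell hw hk hx j
    have hlo0 : ∀ j, 0 ≤ y j := fun j => by
      refine le_trans ?_ (hyc j).1.le
      unfold cellLo
      positivity
    refine ⟨⟨fun j => ?_, fun j => ?_⟩, fun j => hlo0 j, fun j => ?_⟩
    · have h1 := (hyc j).1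
      have h2 := (hyc j).2
      rw [cellLo, ← mul_div_assoc, div_lt_iff₀ hw'] at h1
      rw [cellHi, ← mul_div_assoc, lt_div_iff₀ hw'] at h2
      have f1 : c j * 2 ^ k ≤ ⌊y j * w⌋₊ := Nat.le_floor (by push_cast; exact h1.le)
      have f2 : ⌊y j * w⌋₊ < (c j + 1) * 2 ^ k :=
        (Nat.floor_lt (mul_nonneg (hlo0 j) hw'.le)).2 (by push_cast; exact h2)
      have := hup j
      rw [min_eq_left (by omega)]
      exact Nat.div_eq_of_lt_le f1 f2
    · have := hy j (Set.mem_univ j)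
      by_cases h : σ j
      · simp only [s, h, if_true] at this ⊢
        exact this.1
      · simp only [s, h, if_false, Bool.false_eq_true] at this ⊢
        exact this.2
    · refine (hyc j).2.le.trans ?_
      rw [cellHi, ← mul_div_assoc, Pi.one_apply, div_le_one hw']
      exact_mod_cast hup j
  have hmeas : ∀ j, MeasurableSet (s j) := fun j => by
    by_cases h : σ j
    · simp [s, h]
    · simp [s, h]
  calc ∏ j, ENNReal.ofReal (boxSide w k c σ j (x j)) = ∏ j, volume (s j) := by
        refine Finset.prod_congr rfl fun j _ => ?_
        by_cases h : σ j <;> simp [s, boxSide, h]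
    _ = volume (Set.univ.pi s) := (volume_pi_pi s).symm
    _ = cubeMeasure d (Set.univ.pi s) := by
      rw [cubeMeasure, Measure.restrict_eq_self _ fun y hy => (hsub hy).2]
    _ ≤ _ := measure_mono fun y hy => (hsub hy).1

/-- Since the weight is at most `1`, it is also bounded by the power of its second argument with any
exponent in `[0, 1]`; for an exponent less than `1` this power is integrable over the cell. -/
theorem lintegral_weight_le {d n p w k : ℕ} (hn : 1 ≤ n) (hw : 1 ≤ w) (hk : 2 ^ k ∣ w)
    (c : Fin d → ℕ) (σ : Fin d → Bool) {a : ℝ} (ha : 0 < a) (ha1 : a ≤ 1) :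
    ∫⁻ x in {p | InCell w k c p}, weight (cubeMeasure d) n p (beyond w k c σ) x ∂cubeMeasure d
      ≤ (2 * p / n) ^ (1 - a) * ENNReal.ofReal ((2 ^ k / w) ^ a / a) ^ d := by
  have hw' : (0 : ℝ) < w := by exact_mod_cast hw
  have hn0 : (n : ℝ≥0∞) ≠ 0 := by
    rw [ne_eq, Nat.cast_eq_zero]; omega
  let S : Set (Pt d) := Set.univ.pi fun j => Set.Icc (cellLo w k c j) (cellHi w k c j)
  have hsub : {p : Pt d | InCell w k c p} ∩ Set.Icc 0 1 ⊆ S := fun x hx =>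
    mem_Icc_of_inCell hw hx.1 hx.2
  let G : Pt d → ℝ≥0∞ := fun x => (2 * p / n) ^ (1 - a) *
    ∏ j, ENNReal.ofReal (boxSide w k c σ j (x j)) ^ (a - 1)
  have hGm : ∀ j, Measurable fun t : ℝ => ENNReal.ofReal (boxSide w k c σ j t) ^ (a - 1) := by
    intro j
    have : Measurable (boxSide w k c σ j) := by
      unfold boxSide
      by_cases h : σ j
      · simp only [h, if_true]; fun_prop
      · simp only [h, if_false, Bool.false_eq_true]; fun_prop
    exact (ENNReal.measurable_ofReal.comp this).pow_const _
  have hG : ∀ x ∈ {p : Pt d | InCell w k c p} ∩ Set.Icc 0 1,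
      weight (cubeMeasure d) n p (beyond w k c σ) x ≤ G x := by
    rintro x ⟨hx, hx1⟩
    have hv := prod_boxSide_le hw hk σ hx hx1
    have hmin : ∀ t : ℝ≥0∞, min 1 t ≤ t ^ (1 - a) := fun t => by
      rcases le_total t 1 with ht | ht
      · rw [min_eq_right ht]
        calc t = t ^ (1 : ℝ) := (ENNReal.rpow_one t).symm
          _ ≤ t ^ (1 - a) := ENNReal.rpow_le_rpow_of_exponent_ge ht (by linarith)
      · rw [min_eq_left ht]
        simpa using ENNReal.rpow_le_rpow ht (sub_nonneg.2 ha1)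
    calc weight (cubeMeasure d) n p (beyond w k c σ) x
        ≤ (2 * p / (n * cubeMeasure d (beyond w k c σ x))) ^ (1 - a) := hmin _
      _ ≤ (2 * p / (n * ∏ j, ENNReal.ofReal (boxSide w k c σ j (x j)))) ^ (1 - a) :=
          ENNReal.rpow_le_rpow (ENNReal.div_le_div_left (by gcongr) _) (by linarith)
      _ = G x := by
          rw [div_eq_mul_inv, ENNReal.mul_inv (Or.inl hn0) (Or.inl (ENNReal.natCast_ne_top n)),
            ← mul_assoc, ← div_eq_mul_inv (2 * p : ℝ≥0∞), ENNReal.mul_rpow_of_nonneg _ _ (by linarith),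
            ENNReal.inv_rpow, ← ENNReal.rpow_neg, neg_sub,
            ← ENNReal.prod_rpow_of_ne_top fun _ _ => ENNReal.ofReal_ne_top]
  have hle : ∀ j, cellLo w k c j ≤ cellHi w k c j := fun j => by
    unfold cellLo cellHi
    have : (0 : ℝ) ≤ 2 ^ k / w := by positivity
    nlinarith
  calc _ = ∫⁻ x in {p | InCell w k c p} ∩ Set.Icc 0 1,
        weight (cubeMeasure d) n p (beyond w k c σ) x := by
        conv_lhs => rw [cubeMeasure]
        rw [Measure.restrict_restrict (measurableSet_inCell w k c)]
        rfl
    _ ≤ ∫⁻ x in {p | InCell w k c p} ∩ Set.Icc 0 1, G x :=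
        setLIntegral_mono' ((measurableSet_inCell w k c).inter measurableSet_Icc) hG
    _ ≤ ∫⁻ x in S, G x := lintegral_mono_set hsub
    _ = (2 * p / n) ^ (1 - a) * ∏ j, ∫⁻ t in Set.Icc (cellLo w k c j) (cellHi w k c j),
          ENNReal.ofReal (boxSide w k c σ j t) ^ (a - 1) := by
        have hm : Measurable fun x : Pt d =>
            ∏ j, ENNReal.ofReal (boxSide w k c σ j (x j)) ^ (a - 1) :=
          Finset.measurable_fun_prod _ fun j _ => (hGm j).comp (measurable_pi_apply j)
        rw [lintegral_const_mul _ hm, volume_pi, Measure.restrict_pi_pi,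
          lintegral_pi_prod _ hGm]
    _ = _ := by
        congr 1
        have : ∀ j, ∫⁻ t in Set.Icc (cellLo w k c j) (cellHi w k c j),
            ENNReal.ofReal (boxSide w k c σ j t) ^ (a - 1)
              = ENNReal.ofReal ((2 ^ k / w) ^ a / a) := fun j => by
          have e : cellHi w k c j - cellLo w k c j = 2 ^ k / w := by
            unfold cellLo cellHi; ring
          rw [← e]
          by_cases h : σ j
          · simpa [boxSide, h] using lintegral_rpow_sub_right ha (hle j)
          · simpa [boxSide, h] using lintegral_rpow_sub_left ha (hle j)
        simp [this]

/-! ### Expected running time -/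

/-- The growth factor of the moments of the numbers of vertices from one level of the tree to the
next; the number of sample points per cell grows by its square. -/
def growth (d : ℕ) : ℝ≥0 := NNReal.sqrt (2 ^ d)

theorem growth_sq (d : ℕ) : growth d * growth d = 2 ^ d := NNReal.mul_self_sqrt _

theorem one_le_growth (d : ℕ) : 1 ≤ growth d :=
  NNReal.one_le_sqrt.2 (one_le_pow₀ one_le_two)

/-- The slack between the growth of the moments and the growth `2 ^ d` of the number of nodes. -/
theorem one_add_growth_le {d : ℕ} (hd : 1 ≤ d) : 1 + 4 * growth d ≤ 4 * 2 ^ d := by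
  have h := growth_sq d
  have h2 : (2 : ℝ≥0) ≤ 2 ^ d := by
    calc (2 : ℝ≥0) = 2 ^ 1 := (pow_one _).symm
      _ ≤ 2 ^ d := pow_le_pow_right₀ one_le_two hd
  rw [← h] at h2 ⊢
  rw [← NNReal.coe_le_coe] at h2 ⊢
  push_cast at h2 ⊢
  have h0 : (0 : ℝ) ≤ growth d := (growth d).2
  have h3 : (1.4 : ℝ) ≤ growth d := by
    by_contra! hlt
    nlinarith
  nlinarith

/-- A common bound for the `p`-th moments of the counts at the leaf level. -/
def momentConst (d p : ℕ) : ℕ := 2 ^ p * (2 * p) ^ ((d + 1) * p) + (2 * p) ^ p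

/-- The moment bound for a cell of height `k`: the measure of the cell times the number of sample
points is at most `(2 ^ d) ^ k`, and the exponent `1 / (2 * p)` turns this into its square root. -/
theorem card_mul_lintegral_weight_pow_le {d n p h k : ℕ} (hp : 1 ≤ p) (hn : 1 ≤ n)
    (hnh : n ≤ (2 ^ d) ^ h) (hk : k ≤ h) (c : Fin d → ℕ) (σ : Fin d → Bool) :
    (n * ∫⁻ x in {p | InCell (2 ^ h) k c p},
        weight (cubeMeasure d) n p (beyond (2 ^ h) k c σ) x ∂cubeMeasure d) ^ p
      ≤ (2 * p) ^ ((d + 1) * p) * (growth d : ℝ≥0∞) ^ k := by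
  have hp1 : (1 : ℝ) ≤ p := by exact_mod_cast hp
  have hn0 : (0 : ℝ) < n := by exact_mod_cast hn
  -- this exponent makes the `p`-th power grow like the square root of the number of points
  set a : ℝ := 1 / (2 * p) with ha
  have ha0 : 0 < a := by positivity
  have ha1 : a ≤ 1 := by rw [ha, div_le_one (by positivity)]; linarith
  have hI := lintegral_weight_le hn Nat.one_le_two_pow (pow_dvd_pow 2 hk) c σ ha0 ha1 (p := p)
  set L : ℝ := 2 ^ k / ((2 ^ h : ℕ) : ℝ) with hL
  have hL0 : 0 < L := by positivity
  have hreal : (n : ℝ) * ((2 * p / n) ^ (1 - a) * (L ^ a / a) ^ d)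
      ≤ (2 * p) ^ (d + 1) * ((2 ^ d) ^ k) ^ a := by
    have e1 : (n : ℝ) * (2 * p / n) ^ (1 - a) = (2 * p) ^ (1 - a) * (n : ℝ) ^ a := by
      rw [Real.div_rpow (by positivity) hn0.le, Real.rpow_sub hn0, Real.rpow_one]
      have : (n : ℝ) ^ a ≠ 0 := (Real.rpow_pos_of_pos hn0 a).ne'
      field_simp
    have e2 : (L ^ a / a) ^ d = (L ^ d) ^ a * (2 * p) ^ d := by
      rw [div_pow, ← Real.rpow_natCast (L ^ a), ← Real.rpow_mul hL0.le, mul_comm a,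
        Real.rpow_mul hL0.le, Real.rpow_natCast, ha, one_div, inv_pow, div_inv_eq_mul]
    have e3 : (2 * p : ℝ) ^ (1 - a) ≤ 2 * p := by
      calc (2 * p : ℝ) ^ (1 - a) ≤ (2 * p) ^ (1 : ℝ) :=
            Real.rpow_le_rpow_of_exponent_le (by linarith) (by linarith)
        _ = 2 * p := Real.rpow_one _
    have e4 : (n : ℝ) ^ a * (L ^ d) ^ a ≤ ((2 ^ d) ^ k) ^ a := by
      rw [← Real.mul_rpow hn0.le (by positivity)]
      refine Real.rpow_le_rpow (by positivity) ?_ ha0.le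
      have hW : (n : ℝ) ≤ (2 ^ d) ^ h := by exact_mod_cast hnh
      calc (n : ℝ) * L ^ d ≤ (2 ^ d) ^ h * L ^ d := by gcongr
        _ = (2 ^ d) ^ k := by
          rw [hL]
          push_cast
          rw [div_pow, ← pow_mul, ← pow_mul, ← pow_mul, ← pow_mul, mul_comm h d, mul_comm k d]
          field_simp
    calc (n : ℝ) * ((2 * p / n) ^ (1 - a) * (L ^ a / a) ^ d)
        = ((2 * p) ^ (1 - a) * (2 * p) ^ d) * ((n : ℝ) ^ a * (L ^ d) ^ a) := by
          rw [← mul_assoc, e1, e2]; ring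
      _ ≤ (2 * p * (2 * p) ^ d) * ((2 ^ d) ^ k) ^ a := by gcongr
      _ = _ := by ring
  have hcast : (n : ℝ≥0∞) * ((2 * p / n) ^ (1 - a) * ENNReal.ofReal (L ^ a / a) ^ d)
      = ENNReal.ofReal ((n : ℝ) * ((2 * p / n) ^ (1 - a) * (L ^ a / a) ^ d)) := by
    have hq : (2 * p / n : ℝ≥0∞) = ENNReal.ofReal (2 * p / n) := by
      rw [ENNReal.ofReal_div_of_pos hn0, ENNReal.ofReal_mul (by norm_num)]
      simp
    rw [ENNReal.ofReal_mul hn0.le, ENNReal.ofReal_mul (by positivity),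
      ENNReal.ofReal_pow (by positivity), ← ENNReal.ofReal_rpow_of_pos (by positivity), hq,
      ENNReal.ofReal_natCast]
  have hroot : (((2 ^ d : ℝ) ^ k) ^ a) ^ p = (growth d : ℝ) ^ k := by
    rw [← Real.rpow_natCast (_ ^ a), ← Real.rpow_mul (by positivity), ha]
    have : 1 / (2 * (p : ℝ)) * p = 1 / 2 := by field_simp
    have hsq : ((2 : ℝ) ^ d) ^ k = (√(2 ^ d) ^ k) ^ 2 := by
      rw [← pow_mul (√(2 ^ d)), mul_comm k 2, pow_mul, Real.sq_sqrt (by positivity)]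
    rw [this, ← Real.sqrt_eq_rpow, hsq, Real.sqrt_sq (by positivity), growth, Real.coe_sqrt]
    simp
  calc _ ≤ ((n : ℝ≥0∞) * ((2 * p / n) ^ (1 - a) * ENNReal.ofReal (L ^ a / a) ^ d)) ^ p := by
        gcongr
    _ ≤ (ENNReal.ofReal ((2 * p) ^ (d + 1) * ((2 ^ d) ^ k) ^ a)) ^ p := by
        rw [hcast]
        gcongr
    _ = ENNReal.ofReal ((2 * p) ^ ((d + 1) * p) * (growth d : ℝ) ^ k) := by
        rw [← ENNReal.ofReal_pow (by positivity), mul_pow, hroot, pow_mul]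
    _ = _ := by
        rw [ENNReal.ofReal_mul (by positivity), ENNReal.ofReal_pow (by positivity),
          ENNReal.ofReal_pow (by positivity), ENNReal.ofReal_mul (by norm_num)]
        simp

open Classical in
/-- The number of sample points in a cell that are undominated in it in the direction `σ`. -/
def undominatedCount {d n : ℕ} (w k : ℕ) (c : Fin d → ℕ) (σ : Fin d → Bool) (P : Fin n → Pt d) :
    ℕ :=
  (Finset.univ.filter fun i => P ∈ undominated {p | InCell w k c p} (beyond w k c σ) i).card

open Classical in
/-- The number of sample points in a leaf cell. -/
def pointCount {d n : ℕ} (w : ℕ) (c : Fin d → ℕ) (P : Fin n → Pt d) : ℕ :=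
  (Finset.univ.filter fun i => InCell w 0 c (P i)).card

open Classical in
theorem measurable_card_filter {Ω : Type} [MeasurableSpace Ω] {n : ℕ} {A : Fin n → Set Ω}
    (hA : ∀ i, MeasurableSet (A i)) :
    Measurable fun ω => (Finset.univ.filter fun i => ω ∈ A i).card := by
  simp only [Finset.card_filter]
  exact Finset.measurable_fun_sum _ fun i _ => Measurable.ite (hA i) measurable_const
    measurable_const

theorem measurable_undominatedCount {d n : ℕ} (w k : ℕ) (c : Fin d → ℕ) (σ : Fin d → Bool) :
    Measurable (undominatedCount (n := n) w k c σ) :=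
  measurable_card_filter fun i =>
    measurableSet_undominated (measurableSet_inCell w k c) (measurableSet_beyond w k c σ) i

theorem measurable_pointCount {d n : ℕ} (w : ℕ) (c : Fin d → ℕ) :
    Measurable (pointCount (n := n) w c) := by
  have h : ∀ i : Fin n, MeasurableSet {P : Fin n → Pt d | InCell w 0 c (P i)} := fun i =>
    (measurableSet_inCell w 0 c).preimage (measurable_pi_apply i)
  exact measurable_card_filter h

theorem lintegral_undominatedCount_pow_le {d n p h k : ℕ} (hp : 1 ≤ p) (hn : 1 ≤ n)
    (hnh : n ≤ (2 ^ d) ^ h) (hk : k ≤ h) (c : Fin d → ℕ) (σ : Fin d → Bool) :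
    ∫⁻ P, (undominatedCount (2 ^ h) k c σ P : ℝ≥0∞) ^ p ∂uniformSample d n
      ≤ momentConst d p * (growth d : ℝ≥0∞) ^ k := by
  have h1 : (1 : ℝ≥0∞) ≤ (growth d : ℝ≥0∞) ^ k :=
    one_le_pow₀ (by exact_mod_cast one_le_growth d)
  calc _ ≤ 2 ^ p * (n * ∫⁻ x in {p | InCell (2 ^ h) k c p},
        weight (cubeMeasure d) n p (beyond (2 ^ h) k c σ) x ∂cubeMeasure d) ^ p + (2 * p) ^ p :=
        lintegral_card_undominated_pow_le (cubeMeasure d) hp (measurableSet_inCell _ k c)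
          (measurableSet_beyond _ k c σ)
    _ ≤ 2 ^ p * ((2 * p) ^ ((d + 1) * p) * (growth d : ℝ≥0∞) ^ k)
          + (2 * p) ^ p * (growth d : ℝ≥0∞) ^ k :=
        add_le_add (mul_le_mul_right (card_mul_lintegral_weight_pow_le hp hn hnh hk c σ) _)
          (le_mul_of_one_le_right' h1)
    _ = _ := by
        unfold momentConst
        push_cast
        ring

theorem lintegral_pointCount_pow_le {d n p h : ℕ} (hp : 1 ≤ p) (hnh : n ≤ (2 ^ d) ^ h)
    (c : Fin d → ℕ) :
    ∫⁻ P, (pointCount (2 ^ h) c P : ℝ≥0∞) ^ p ∂uniformSample d n ≤ momentConst d p := by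
  classical
  have hw : 1 ≤ 2 ^ h := Nat.one_le_two_pow
  -- no point is dominated if the dominating sets are empty
  have hund : ∀ P : Fin n → Pt d, pointCount (2 ^ h) c P = (Finset.univ.filter fun i =>
      P ∈ undominated {p | InCell (2 ^ h) 0 c p} (fun _ => ∅) i).card := fun P => by
    unfold pointCount
    congr 1
    ext i
    simp [undominated]
  have hvol : cubeMeasure d {p | InCell (2 ^ h) 0 c p} ≤ ENNReal.ofReal ((1 / 2 ^ h) ^ d) := by
    rw [cubeMeasure, Measure.restrict_apply (measurableSet_inCell _ _ _)]
    refine (measure_mono fun x hx => mem_Icc_of_inCell hw hx.1 hx.2).trans ?_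
    have e : ∀ j, cellHi (2 ^ h) 0 c j - cellLo (2 ^ h) 0 c j = 1 / 2 ^ h := fun j => by
      unfold cellLo cellHi
      push_cast
      ring
    rw [volume_pi_pi]
    simp only [Real.volume_Icc, e, Finset.prod_const, Finset.card_univ, Fintype.card_fin]
    rw [ENNReal.ofReal_pow (by positivity)]
  have hle : (n : ℝ≥0∞) * ∫⁻ x in {p | InCell (2 ^ h) 0 c p},
      weight (cubeMeasure d) n p (fun _ => ∅) x ∂cubeMeasure d ≤ 1 := by
    calc _ ≤ (n : ℝ≥0∞) * ∫⁻ x in {p | InCell (2 ^ h) 0 c p}, 1 ∂cubeMeasure d := by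
          gcongr
          exact min_le_left _ _
      _ ≤ ((2 ^ d) ^ h : ℕ) * ENNReal.ofReal ((1 / 2 ^ h) ^ d) := by
          rw [setLIntegral_one]
          gcongr
      _ = ENNReal.ofReal (((2 ^ d) ^ h : ℕ) * (1 / 2 ^ h) ^ d) := by
          rw [ENNReal.ofReal_mul (by positivity), ENNReal.ofReal_natCast]
      _ = 1 := by
          rw [← ENNReal.ofReal_one]
          congr 1
          push_cast
          rw [one_div, inv_pow, ← pow_mul, ← pow_mul, mul_comm h d]
          exact mul_inv_cancel₀ (by positivity)
  have hmeas : MeasurableSet {q : Pt d × Pt d | q.2 ∈ (fun _ : Pt d => (∅ : Set (Pt d))) q.1} := by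
    simp
  simp only [hund]
  calc _ ≤ 2 ^ p * (n * ∫⁻ x in {p | InCell (2 ^ h) 0 c p},
        weight (cubeMeasure d) n p (fun _ => ∅) x ∂cubeMeasure d) ^ p + (2 * p) ^ p :=
        lintegral_card_undominated_pow_le (cubeMeasure d) hp (measurableSet_inCell _ 0 c) hmeas
    _ ≤ 2 ^ p * 1 ^ p + (2 * p) ^ p := by gcongr
    _ ≤ _ := by
        unfold momentConst
        have : 1 ≤ (2 * p) ^ ((d + 1) * p) := Nat.one_le_pow _ _ (by omega)
        have : 2 ^ p * 1 ^ p ≤ 2 ^ p * (2 * p) ^ ((d + 1) * p) := by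
          rw [one_pow]; exact Nat.mul_le_mul_left _ this
        exact_mod_cast Nat.add_le_add_right this _

/-- The bound on the running time of the traversal of a subtree, as a function of the sample. -/
def sampleCost {d n : ℕ} (K p w k : ℕ) (c : Fin d → ℕ) (P : Fin n → Pt d) : ℕ :=
  costBound K p (fun c => pointCount w c P) (fun k c => ∑ σ, undominatedCount w k c σ P) k c

theorem measurable_sampleCost {d n : ℕ} (K p w k : ℕ) (c : Fin d → ℕ) :
    Measurable (sampleCost (n := n) K p w k c) := by
  induction k generalizing c with
  | zero =>
    exact (((measurable_pointCount w c).add_const 1).pow_const p).const_mul K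
  | succ k ih =>
    refine (Finset.measurable_fun_sum _ fun b _ => ih _).add ?_
    refine ((Measurable.add_const ?_ 1).pow_const p).const_mul K
    exact Finset.measurable_fun_sum _ fun b _ => Finset.measurable_fun_sum _ fun σ _ =>
      measurable_undominatedCount w k _ σ

theorem add_one_pow_le (x p : ℕ) : (x + 1) ^ p ≤ 2 ^ p * (x ^ p + 1) := by
  rcases Nat.eq_zero_or_pos x with rfl | hx
  · have : 1 ≤ 2 ^ p := Nat.one_le_two_pow
    simp only [zero_add, one_pow]
    nlinarith [Nat.zero_le (0 ^ p : ℕ)]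
  · calc (x + 1) ^ p ≤ (2 * x) ^ p := Nat.pow_le_pow_left (by omega) p
      _ = 2 ^ p * x ^ p := mul_pow _ _ _
      _ ≤ _ := Nat.mul_le_mul_left _ (Nat.le_succ _)

/-- Bound for the expected cost of merging, relative to the growth of the moments. -/
def mergeConst (d K κ : ℕ) : ℕ :=
  K * (2 ^ (κ + 1) * ((2 ^ d * 2 ^ d) ^ κ * (2 ^ d * 2 ^ d * momentConst d (κ + 1)) + 1))

theorem lintegral_merge_le {d n h k K κ : ℕ} (hn : 1 ≤ n) (hnh : n ≤ (2 ^ d) ^ h) (hk : k ≤ h)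
    (c : Fin d → ℕ) :
    ∫⁻ P, ((K * (∑ b, ∑ σ, undominatedCount (2 ^ h) k (childCellT c b).val σ P + 1) ^ (κ + 1) : ℕ)
        : ℝ≥0∞) ∂uniformSample d n ≤ mergeConst d K κ * (growth d : ℝ≥0∞) ^ k := by
  have h1 : (1 : ℝ≥0∞) ≤ (growth d : ℝ≥0∞) ^ k :=
    one_le_pow₀ (by exact_mod_cast one_le_growth d)
  set Z : Fin (2 ^ d) × (Fin d → Bool) → (Fin n → Pt d) → ℕ := fun q P =>
    undominatedCount (2 ^ h) k (childCellT c q.1).val q.2 P with hZ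
  have hcard : (Finset.univ : Finset (Fin (2 ^ d) × (Fin d → Bool))).card = 2 ^ d * 2 ^ d := by
    simp [Finset.card_univ]
  have hZm : ∀ q, Measurable fun P => (Z q P : ℝ≥0∞) ^ (κ + 1) := fun q =>
    (measurable_from_top.comp (measurable_undominatedCount _ k _ _)).pow_const _
  have hpt : ∀ P : Fin n → Pt d,
      ((K * (∑ b, ∑ σ, undominatedCount (2 ^ h) k (childCellT c b).val σ P + 1) ^ (κ + 1) : ℕ)
        : ℝ≥0∞) ≤ K * (2 ^ (κ + 1) *
          ((2 ^ d * 2 ^ d) ^ κ * ∑ q, (Z q P : ℝ≥0∞) ^ (κ + 1) + 1)) := by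
    intro P
    have e : ∑ b, ∑ σ, undominatedCount (2 ^ h) k (childCellT c b).val σ P = ∑ q, Z q P :=
      (Fintype.sum_prod_type fun q => Z q P).symm
    have k1 := add_one_pow_le (∑ q, Z q P) (κ + 1)
    have k2 : (∑ q, Z q P) ^ (κ + 1) ≤ (2 ^ d * 2 ^ d) ^ κ * ∑ q, Z q P ^ (κ + 1) := by
      rw [← hcard]
      exact pow_sum_le_card_mul_sum_pow (fun _ _ => Nat.zero_le _) κ
    rw [e]
    exact_mod_cast Nat.mul_le_mul_left K
      (k1.trans (Nat.mul_le_mul_left _ (Nat.add_le_add_right k2 1)))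
  have hm := Finset.measurable_fun_sum (Finset.univ) fun q _ => hZm q
  calc _ ≤ ∫⁻ P, (K : ℝ≥0∞) * (2 ^ (κ + 1) *
          ((2 ^ d * 2 ^ d) ^ κ * ∑ q, (Z q P : ℝ≥0∞) ^ (κ + 1) + 1)) ∂uniformSample d n :=
        lintegral_mono hpt
    _ = (K : ℝ≥0∞) * (2 ^ (κ + 1) * ((2 ^ d * 2 ^ d) ^ κ *
          ∑ q, ∫⁻ P, (Z q P : ℝ≥0∞) ^ (κ + 1) ∂uniformSample d n + 1)) := by
        rw [lintegral_const_mul _ (((hm.const_mul _).add_const _).const_mul _),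
          lintegral_const_mul _ ((hm.const_mul _).add_const _),
          lintegral_add_right _ measurable_const, lintegral_const_mul _ hm,
          lintegral_finsetSum _ fun q _ => hZm q]
        simp
    _ ≤ (K : ℝ≥0∞) * (2 ^ (κ + 1) * ((2 ^ d * 2 ^ d) ^ κ *
          ∑ q : Fin (2 ^ d) × (Fin d → Bool), momentConst d (κ + 1) * (growth d : ℝ≥0∞) ^ k
            + (growth d : ℝ≥0∞) ^ k)) := by
        gcongr with q
        exact lintegral_undominatedCount_pow_le (by omega) hn hnh hk _ _
    _ = _ := by
        rw [Finset.sum_const, hcard, nsmul_eq_mul]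
        unfold mergeConst
        push_cast
        ring

/-- Bound for the expected cost at a leaf. -/
def leafConst (d K κ : ℕ) : ℕ := K * (2 ^ (κ + 1) * (momentConst d (κ + 1) + 1))

theorem lintegral_leaf_le {d n h K κ : ℕ} (hnh : n ≤ (2 ^ d) ^ h) (c : Fin d → ℕ) :
    ∫⁻ P, (sampleCost K (κ + 1) (2 ^ h) 0 c P : ℝ≥0∞) ∂uniformSample d n ≤ leafConst d K κ := by
  have hm : Measurable fun P : Fin n → Pt d => (pointCount (2 ^ h) c P : ℝ≥0∞) ^ (κ + 1) :=
    (measurable_from_top.comp (measurable_pointCount _ c)).pow_const _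
  calc _ ≤ ∫⁻ P, (K : ℝ≥0∞) * (2 ^ (κ + 1) * ((pointCount (2 ^ h) c P : ℝ≥0∞) ^ (κ + 1) + 1))
          ∂uniformSample d n := by
        refine lintegral_mono fun P => ?_
        have := Nat.mul_le_mul_left K (add_one_pow_le (pointCount (2 ^ h) c P) (κ + 1))
        simp only [sampleCost, costBound]
        exact_mod_cast this
    _ = (K : ℝ≥0∞) * (2 ^ (κ + 1) *
          (∫⁻ P, (pointCount (2 ^ h) c P : ℝ≥0∞) ^ (κ + 1) ∂uniformSample d n + 1)) := by
        rw [lintegral_const_mul _ ((hm.add_const _).const_mul _),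
          lintegral_const_mul _ (hm.add_const _), lintegral_add_right _ measurable_const]
        simp
    _ ≤ (K : ℝ≥0∞) * (2 ^ (κ + 1) * (momentConst d (κ + 1) + 1)) := by
        gcongr
        exact lintegral_pointCount_pow_le (by omega) hnh c
    _ = _ := by
        unfold leafConst
        push_cast
        ring

/-- The expected cost of a subtree is proportional to its number of leaves. The additional term on
the left-hand side absorbs the cost of merging, which grows more slowly than the number of
leaves. -/
theorem lintegral_sampleCost_le {d n h K κ : ℕ} (hd : 1 ≤ d) (hn : 1 ≤ n) (hnh : n ≤ (2 ^ d) ^ h)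
    (k : ℕ) (hk : k ≤ h) (c : Fin d → ℕ) :
    ∫⁻ P, (sampleCost K (κ + 1) (2 ^ h) k c P : ℝ≥0∞) ∂uniformSample d n
        + 4 * mergeConst d K κ * (growth d : ℝ≥0∞) ^ k
      ≤ (leafConst d K κ + 4 * mergeConst d K κ : ℕ) * (2 ^ d) ^ k := by
  induction k generalizing c with
  | zero =>
    push_cast
    rw [pow_zero, pow_zero, mul_one, mul_one]
    exact add_le_add_left (lintegral_leaf_le hnh c) _
  | succ k ih =>
    set g : ℝ≥0∞ := (growth d : ℝ≥0∞) with hg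
    set I : Fin (2 ^ d) → ℝ≥0∞ := fun b =>
      ∫⁻ P, (sampleCost K (κ + 1) (2 ^ h) k (childCellT c b).val P : ℝ≥0∞) ∂uniformSample d n
      with hI
    have hrec : ∫⁻ P, (sampleCost K (κ + 1) (2 ^ h) (k + 1) c P : ℝ≥0∞) ∂uniformSample d n
        ≤ ∑ b, I b + mergeConst d K κ * g ^ k := by
      have hm : ∀ b, Measurable fun P : Fin n → Pt d =>
          (sampleCost K (κ + 1) (2 ^ h) k (childCellT c b).val P : ℝ≥0∞) := fun b =>
        measurable_from_top.comp (measurable_sampleCost _ _ _ _ _)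
      rw [hI, ← lintegral_finsetSum _ fun b _ => hm b]
      refine le_trans (le_of_eq ?_)
        (add_le_add_right (lintegral_merge_le hn hnh (Nat.le_of_succ_le hk) c) _)
      rw [← lintegral_add_left (Finset.measurable_fun_sum _ fun b _ => hm b)]
      refine lintegral_congr fun P => ?_
      rw [← Nat.cast_sum, ← Nat.cast_add]
      rfl
    have habs : mergeConst d K κ * g ^ k + 4 * mergeConst d K κ * g ^ (k + 1)
        ≤ 4 * mergeConst d K κ * (2 ^ d * g ^ k) := by
      have h1 : 1 + 4 * g ≤ 4 * 2 ^ d := by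
        have := ENNReal.coe_le_coe.2 (one_add_growth_le hd)
        push_cast at this
        exact this
      calc _ = (mergeConst d K κ : ℝ≥0∞) * g ^ k * (1 + 4 * g) := by ring
        _ ≤ (mergeConst d K κ : ℝ≥0∞) * g ^ k * (4 * 2 ^ d) := by gcongr
        _ = _ := by ring
    calc _ ≤ ∑ b, I b + mergeConst d K κ * g ^ k + 4 * mergeConst d K κ * g ^ (k + 1) := by
          gcongr
      _ ≤ ∑ b, I b + 4 * mergeConst d K κ * (2 ^ d * g ^ k) := by
          rw [add_assoc]
          gcongr
      _ = ∑ b, (I b + 4 * mergeConst d K κ * g ^ k) := by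
          rw [Finset.sum_add_distrib, Finset.sum_const, Finset.card_univ, Fintype.card_fin,
            nsmul_eq_mul]
          push_cast
          ring
      _ ≤ ∑ b : Fin (2 ^ d),
            ((leafConst d K κ + 4 * mergeConst d K κ : ℕ) : ℝ≥0∞) * (2 ^ d) ^ k :=
          Finset.sum_le_sum fun b _ => ih (Nat.le_of_succ_le hk) _
      _ = _ := by
          rw [Finset.sum_const, Finset.card_univ, Fintype.card_fin, nsmul_eq_mul]
          push_cast
          ring

theorem time_quadtreeHull_le {d c κ n : ℕ} (hd : 1 ≤ d) (hn : 1 ≤ n)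
    {leafHull mergeHull : List (Pt d) → Timed (Hull d)}
    (hl : ComputesHull leafHull) (hlt : RunsInTime leafHull c κ)
    (hm : ComputesHull mergeHull) (hmt : RunsInTime mergeHull c κ) (P : Fin n → Pt d) :
    (quadtreeHull leafHull mergeHull (List.ofFn P)).time ≤ (22 * d + 23) * leafCount d n
      + sampleCost (4 * 2 ^ d + 4 + c) (κ + 1) (2 ^ Nat.clog (2 ^ d) n) (Nat.clog (2 ^ d) n) 0
        P := by
  classical
  have hY : ∀ k x, (traverseT leafHull mergeHull (buildTreeT
      (leafGrid (2 ^ Nat.clog (2 ^ d) n) (List.ofFn P)) k x).val).val.vertices.length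
        ≤ ∑ σ, undominatedCount (2 ^ Nat.clog (2 ^ d) n) k x σ P := fun k x => by
    refine (vertices_length_le hd hl hm _ k x P).trans (le_of_eq ?_)
    refine Finset.sum_congr rfl fun σ _ => ?_
    unfold undominatedCount
    congr 1
    ext i
    simp only [Finset.mem_filter]
    rfl
  have h1 := quadTreeT_time_le hd (List.ofFn P) (by simpa using hn)
  have h2 := traverseT_time_le hlt hmt (leafGrid (2 ^ Nat.clog (2 ^ d) n) (List.ofFn P))
    (fun k x => ∑ σ, undominatedCount (2 ^ Nat.clog (2 ^ d) n) k x σ P) hY (Nat.clog (2 ^ d) n) 0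
  have hN : (fun x => (leafGrid (2 ^ Nat.clog (2 ^ d) n) (List.ofFn P) x).length)
      = fun x => pointCount (2 ^ Nat.clog (2 ^ d) n) x P := by
    funext x
    rw [leafGrid_length]
    unfold pointCount
    congr 1
  rw [hN] at h2
  simp only [quadtreeHull, time_bind, quadTreeT_val hd, List.length_ofFn] at h1 h2 ⊢
  exact Nat.add_le_add h1 h2

/-- The constant in the linear bound on the expected running time. -/
def timeConst (d c κ : ℕ) : ℕ :=
  (22 * d + 23 + (leafConst d (4 * 2 ^ d + 4 + c) κ + 4 * mergeConst d (4 * 2 ^ d + 4 + c) κ))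
    * 2 ^ d

theorem expectedTime_quadtreeHull_le {d c κ n : ℕ} (hd : 1 ≤ d) (hn : 1 ≤ n)
    {leafHull mergeHull : List (Pt d) → Timed (Hull d)}
    (hl : ComputesHull leafHull) (hlt : RunsInTime leafHull c κ)
    (hm : ComputesHull mergeHull) (hmt : RunsInTime mergeHull c κ) :
    expectedTime (quadtreeHull leafHull mergeHull) n ≤ ((timeConst d c κ : ℕ) : ℝ≥0) * n := by
  set h := Nat.clog (2 ^ d) n with hh
  set K := 4 * 2 ^ d + 4 + c with hK
  have hms : Measurable fun P : Fin n → Pt d =>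
      (sampleCost K (κ + 1) (2 ^ h) h 0 P : ℝ≥0∞) :=
    measurable_from_top.comp (measurable_sampleCost _ _ _ _ _)
  have hcost := lintegral_sampleCost_le (K := K) (κ := κ) hd hn (le_leafCount hd n) h le_rfl 0
  have hW : ((2 : ℝ≥0∞) ^ d) ^ h = (leafCount d n : ℕ) := by
    simp [leafCount, hh]
  rw [hW] at hcost
  calc expectedTime (quadtreeHull leafHull mergeHull) n
      ≤ ∫⁻ P, (((22 * d + 23) * leafCount d n : ℕ)
          + (sampleCost K (κ + 1) (2 ^ h) h 0 P : ℝ≥0∞)) ∂uniformSample d n := by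
        refine iInf_le_of_le _ (iInf_le_of_le (hms.const_add _) (iInf_le _ fun P => ?_))
        change (((quadtreeHull leafHull mergeHull (List.ofFn P)).time : ℕ) : ℝ≥0∞)
          ≤ (((22 * d + 23) * leafCount d n : ℕ) : ℝ≥0∞)
            + (sampleCost K (κ + 1) (2 ^ h) h 0 P : ℝ≥0∞)
        rw [← Nat.cast_add, Nat.cast_le]
        exact time_quadtreeHull_le hd hn hl hlt hm hmt P
    _ = ((22 * d + 23) * leafCount d n : ℕ)
          + ∫⁻ P, (sampleCost K (κ + 1) (2 ^ h) h 0 P : ℝ≥0∞) ∂uniformSample d n := by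
        rw [lintegral_add_left measurable_const, lintegral_const, measure_univ, mul_one]
    _ ≤ ((22 * d + 23) * leafCount d n : ℕ)
          + (leafConst d K κ + 4 * mergeConst d K κ : ℕ) * (leafCount d n : ℕ) := by
        gcongr
        exact le_self_add.trans hcost
    _ ≤ _ := by
        have h1 := Nat.mul_le_mul_left
          (22 * d + 23 + (leafConst d K κ + 4 * mergeConst d K κ)) (leafCount_le hd hn)
        have h2 : (22 * d + 23) * leafCount d n
            + (leafConst d K κ + 4 * mergeConst d K κ) * leafCount d n ≤ timeConst d c κ * n := by
          rw [timeConst, ← add_mul, mul_assoc]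
          exact h1
        exact_mod_cast h2

end QuadtreeHull

end

theorem mainTheorem6 (d : ℕ) (hd : 1 ≤ d) :
    (QuadtreeHull.ComputesHull (d := d)
        (QuadtreeHull.quadtreeHull QuadtreeHull.bruteForceHull QuadtreeHull.bruteForceHull) ∧
      ∃ C : ℝ≥0, ∀ n : ℕ, 1 ≤ n →
        QuadtreeHull.expectedTime (d := d)
          (QuadtreeHull.quadtreeHull QuadtreeHull.bruteForceHull QuadtreeHull.bruteForceHull) n
          ≤ C * n) ∧
    (∀ c κ : ℕ, ∃ C : ℝ≥0,
      ∀ leafHull mergeHull : List (QuadtreeHull.Pt d) → QuadtreeHull.Timed (QuadtreeHull.Hull d),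
        QuadtreeHull.ComputesHull leafHull → QuadtreeHull.RunsInTime leafHull c κ →
        QuadtreeHull.ComputesHull mergeHull → QuadtreeHull.RunsInTime mergeHull c κ →
        QuadtreeHull.ComputesHull (QuadtreeHull.quadtreeHull leafHull mergeHull) ∧
        ∀ n : ℕ, 1 ≤ n →
          QuadtreeHull.expectedTime (QuadtreeHull.quadtreeHull leafHull mergeHull) n
            ≤ C * n) := by
  refine ⟨⟨QuadtreeHull.quadtreeHull_computesHull hd
    (QuadtreeHull.bruteForceHull_computesHull d) (QuadtreeHull.bruteForceHull_computesHull d), ?_⟩,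
    fun c κ => ⟨QuadtreeHull.timeConst d c κ, fun leafHull mergeHull hl hlt hm hmt =>
      ⟨QuadtreeHull.quadtreeHull_computesHull hd hl hm, fun n hn =>
        QuadtreeHull.expectedTime_quadtreeHull_le hd hn hl hlt hm hmt⟩⟩⟩
  obtain ⟨c, κ, ht⟩ := QuadtreeHull.bruteForceHull_runsInTime d
  exact ⟨QuadtreeHull.timeConst d c κ, fun n hn =>
    QuadtreeHull.expectedTime_quadtreeHull_le hd hn (QuadtreeHull.bruteForceHull_computesHull d) ht
      (QuadtreeHull.bruteForceHull_computesHull d) ht⟩
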